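/- Let $n \ge 2$ and let $A \in \mathbb{R}^{n\times n}$ be symmetric with orthonormal eigenvectors $u_1,\dots,u_n$ and eigenvalues $\lambda_1 > \lambda_2 \ge \dots \ge \lambda_n$; put $\Delta = \lambda_1-\lambda_2$. Assume that $A$ is incoherent with parameter $\mu$: $(e_j^T u_k)^2 \le \mu^2/n$ for all $j,k$, where $e_1,\dots,e_n$ is the standard basis. Let $\epsilon > 0$, $0<\gamma\le 1$, $0<\vartheta<(1+\epsilon)^{-1}$, and $$\eta = \frac{\Delta\epsilon\gamma\vartheta}{2n\mu^4\|A\|_F^2}, \qquad T = \frac{4n\mu^4\|A\|_F^2}{\Delta^2\epsilon\gamma\vartheta\sqrt{2\pi\gamma}}\,\log\left(\frac{en}{\gamma\epsilon}\right).$$ Consider asynchronous (Hogwild!) Alecton: $x_0$ is uniformly distributed on a sphere of some radius $r > 0$ centered at the origin in $\mathbb{R}^n$, and for $t = 0,1,2,\dots$ $$x_{t+1} = x_t + \eta n^2\, e_{i_t}e_{i_t}^T A\, e_{j_t}e_{j_t}^T v_t, \qquad e_k^T v_t = e_k^T x_{t-\tau_{k,t}} \quad (1 \le k \le n),$$ where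 $x_s = x_0$ for $s<0$ and the delays $\tau_{k,t}$ are random nonnegative integers. Let $(\mathcal{F}_t)$ be a filtration such that $\mathcal{F}_t$ contains all events that occur before step $t$: $x_0$ is $\mathcal{F}_0$-measurable, and $i_t, j_t, \tau_{1,t},\dots,\tau_{n,t}$ are $\mathcal{F}_{t+1}$-measurable. For each $t$, the pair $(i_t,j_t)$ is uniform on $\{1,\dots,n\}^2$ and independent of $\mathcal{F}_t$ and $(\tau_{k,t})_{k}$ jointly. The delays are bounded by a random variable $\tilde\tau$ with values in the nonnegative integers and finite mean $\tau = \mathbf{E}[\tilde\tau]$, in the sense that almost surely $\mathbf{P}(\tau_{k,t}\ge m \mid \mathcal{F}_t) \le \mathbf{P}(\tilde\tau \ge m)$ for all $k,t,m$. Assume that for some constant $C$, almost surely $1\le\|x_t\|$ and $\|x_t\|_1\le C$ for all steps $0 \le t\le T$ of the run, and that $4C\vartheta\tau\sqrt\epsilon < \mu^2$. Let $F_T$ be the event that the run fails, i.e. that no iterate $x_t$ with $t$ an integer, $0\le t\le T$, satisfies $(u_1^T x_t)^2 \ge (1-\epsilon)\|x_t\|^2$. (If $T<0$, which can happen only for $\epsilon>1$,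 only $t=0$ is considered.) Then $$\mathbf{P}(F_T) \le \frac{\sqrt{8\pi\gamma}\,\mu^2}{\mu^2 - 4C\vartheta\tau\sqrt\epsilon}.$$ -/

import Mathlib

open MeasureTheory ProbabilityTheory

namespace Alecton

/-- The Frobenius norm of a real square matrix. -/
noncomputable def frobeniusNorm {n : ℕ} (A : Matrix (Fin n) (Fin n) ℝ) : ℝ :=
  Real.sqrt (∑ a, ∑ b, A a b ^ 2)

/-- The 1-norm of a vector. -/
def l1Norm {n : ℕ} (x : EuclideanSpace ℝ (Fin n)) : ℝ := ∑ k, |x k|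

/-- The orthonormal basis `u` consists of eigenvectors of `A`, and `lam k` is the eigenvalue of
`u k`; the eigenvalues are listed in non-increasing order. -/
structure IsOrderedEigenbasis {n : ℕ} (A : Matrix (Fin n) (Fin n) ℝ)
    (u : OrthonormalBasis (Fin n) ℝ (EuclideanSpace ℝ (Fin n))) (lam : Fin n → ℝ) : Prop where
  eigen : ∀ k, Matrix.toEuclideanLin A (u k) = lam k • u k
  antitone : Antitone lam

/-- The unit eigenvectors `u k` are incoherent with parameter `μ`: `(e_b ⬝ u_k)² ≤ μ² / n`. -/
def Incoherent {n : ℕ} (u : OrthonormalBasis (Fin n) ℝ (EuclideanSpace ℝ (Fin n)))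
    (μ : ℝ) : Prop :=
  ∀ b k : Fin n, (u k b) ^ 2 ≤ μ ^ 2 / n

/-- The success set `S = {x | (u₁ ⬝ x)² ≥ (1 - ε) ‖x‖²}`. -/
def successSet {n : ℕ} (u₁ : EuclideanSpace ℝ (Fin n)) (ε : ℝ) :
    Set (EuclideanSpace ℝ (Fin n)) :=
  {x | (inner ℝ u₁ x) ^ 2 ≥ (1 - ε) * ‖x‖ ^ 2}

/-- The uniform probability distribution on the sphere of radius `r` centered at the origin:
the image under `y ↦ r • y` of the normalized surface measure of the unit sphere. -/
noncomputable def uniformSphere (n : ℕ) (r : ℝ) : Measure (EuclideanSpace ℝ (Fin n)) :=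
  let σ := (volume : Measure (EuclideanSpace ℝ (Fin n))).toSphere
  Measure.map (fun y : Metric.sphere (0 : EuclideanSpace ℝ (Fin n)) 1 =>
    r • (y : EuclideanSpace ℝ (Fin n))) ((σ Set.univ)⁻¹ • σ)

/-- The increment `η n² e_a e_aᵀ A e_b e_bᵀ v` that Alecton adds to the iterate when the entry
`(a, b)` of `A` is sampled and the vector `v` is read. -/
noncomputable def increment {n : ℕ} (A : Matrix (Fin n) (Fin n) ℝ) (η : ℝ) (a b : Fin n)
    (v : EuclideanSpace ℝ (Fin n)) : EuclideanSpace ℝ (Fin n) :=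
  EuclideanSpace.single a (η * (n : ℝ) ^ 2 * A a b * v b)

/-- The cached vector read at step `t`, when coordinate `k` is delayed by `d k`: its coordinate
`k` is that of `x_{t - d k}`. Subtraction is truncated, so that `x_s = x_0` for `s < 0`. -/
noncomputable def staleRead {n : ℕ} (x : ℕ → EuclideanSpace ℝ (Fin n)) (t : ℕ) (d : Fin n → ℕ) :
    EuclideanSpace ℝ (Fin n) :=
  WithLp.toLp 2 (fun k => x (t - d k) k)

/-- `x` is the sequence of values in the central store of an asynchronous run of rank-1 Alecton
with entrywise sampling, with step size `η` and initial radius `r`. Here `(row t, col t)` is the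
entry of `A` sampled for write `t`, `delay t k` is the delay of coordinate `k` in the vector read
for write `t`, `ℱ t` contains all events that occur before write `t`, and `tauMax` is the random
variable, possibly on another probability space, that bounds the delays. -/
structure IsHogwildRun {n : ℕ} {Ω Ω' : Type*} {mΩ : MeasurableSpace Ω} {mΩ' : MeasurableSpace Ω'}
    (P : Measure Ω) (P' : Measure Ω') (ℱ : Filtration ℕ mΩ)
    (A : Matrix (Fin n) (Fin n) ℝ) (η r : ℝ)
    (x : ℕ → Ω → EuclideanSpace ℝ (Fin n)) (row col : ℕ → Ω → Fin n)
    (delay : ℕ → Fin n → Ω → ℕ) (tauMax : Ω' → ℕ) : Prop where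
  measurable_init : Measurable[ℱ 0] (x 0)
  /-- The run starts at a uniformly random point of a sphere. -/
  init_law : P.map (x 0) = uniformSphere n r
  measurable_row : ∀ t, Measurable[ℱ (t + 1)] (row t)
  measurable_col : ∀ t, Measurable[ℱ (t + 1)] (col t)
  measurable_delay : ∀ t k, Measurable[ℱ (t + 1)] (delay t k)
  /-- Each sampled entry is uniform among the `n²` entries. -/
  sample_uniform : ∀ t a b, P.real {ω | row t ω = a ∧ col t ω = b} = 1 / (n : ℝ) ^ 2
  /-- Each sample is drawn independently of the past (hence of the earlier samples) and of the
  delays that determine the vector to which it is applied. -/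
  sample_indep : ∀ t, Indep
    (MeasurableSpace.comap (fun ω => (row t ω, col t ω)) inferInstance)
    (ℱ t ⊔ MeasurableSpace.comap (fun ω k => delay t k ω) inferInstance) P
  /-- `P(delay t k ≥ m | ℱ t) ≤ P(tauMax ≥ m)`. -/
  delay_tail : ∀ t k (m : ℕ),
    P⟦{ω | m ≤ delay t k ω} | ℱ t⟧ ≤ᵐ[P] fun _ => P'.real {ω' | m ≤ tauMax ω'}
  /-- `x_{t+1} = x_t + η n² e_i e_iᵀ A e_j e_jᵀ v_t`, with `(i, j)` the sampled entry. -/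
  update : ∀ t ω, x (t + 1) ω = x t ω +
    increment A η (row t ω) (col t ω) (staleRead (fun s => x s ω) t (fun k => delay t k ω))

/-- The failure event: no iterate `x_t` with `0 ≤ t ≤ T` is in `S`. -/
def failureEvent {n : ℕ} {Ω : Type*} (x : ℕ → Ω → EuclideanSpace ℝ (Fin n))
    (S : Set (EuclideanSpace ℝ (Fin n))) (T : ℝ) : Set Ω :=
  {ω | ∀ t : ℕ, t ≤ ⌊T⌋₊ → x t ω ∉ S}

end Alecton

/-! Write y = u₁ᵀx, ρ = ‖x‖² - y², g = γ/n. Progress is measured by the `defect` θ = gρ/(y² + gρ),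
the squared sine of the angle to u₁ after the complement of u₁ has been shrunk by √g. The weight g
suits the start: a random direction has y² of order ‖x‖²/n, so θ has mean O(√γ) initially, whereas θ
≥ γε/n outside the success set (`Regime.state_bounds`). A failing run either reaches θ > 1/2 or
keeps θ between γε/n and 1/2 up to time T, and both are improbable.

Fresh reads. θ is the squared distance from u₁ to a line, hence at most ‖u₁ - s • stretch x‖² for
every s. With s frozen at its optimum for the current x, this bound is quadratic in the write and
can be averaged over the sampled entry: the gap Δ contracts θ, and incoherence and the step size
keep the second-order term smaller (`Regime.entryAvg_fresh_le`).

Stale reads. Reading x + w perturbs the write. In √θ, which is a distance, the error enters linearly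
by the triangle inequality (`sqrt_defect_add_le`), with a coefficient proportional to √θ, so only
the mean of ‖w‖₁ matters. That mean is at most D, the sum over past writes of length times delay
tail probability (`IsHogwildRun.lintegral_staleness_le`). Since the tails sum to at most τ, a write
of length ℓ causes total staleness at most τℓ; `pendingStaleness` S keeps the account, with S_{t+1}
= S_t - D_t + τℓ_t. The factor exp(κS) prepays the damage: √θ·exp(κS) shrinks in mean by
exp(-ηΔ(1-X)/4) per step (`Regime.lintegral_weightedDefect_le`), where X = 4Cϑτ√ε/μ² bounds the
share of progress lost to asynchrony. The stale error in θ itself is only bounded by a multiple of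
√θ, but θ + √γ·√θ·exp(κS) does not grow in mean (`Regime.lintegral_defect_add_le`).

Conclusion. A maximal inequality for the second potential bounds the probability of θ > 1/2 by 2(E
θ₀ + √γ) (`Regime.sum_measure_exitAt_le`), and the decay of the first bounds the probability of
surviving below 1/2 (`Regime.measure_activeBefore_le`). Replacing the sphere by a Gaussian gives E
θ₀ ≤ √(πγ/2) (`lintegral_defect_uniformSphere_le`). The total is at most √(8πγ) provided T is long
enough, which is what √(8πγ) < 1 - X ensures; otherwise the claimed bound is at least 1. -/

namespace Alecton

/-! ### Geometry of the defect. -/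

section Geometry

variable {V : Type*} [NormedAddCommGroup V] [InnerProductSpace ℝ V]

/-- The linear map that fixes the unit vector `u` and multiplies its orthogonal complement
by `c`. -/
noncomputable def stretch (u : V) (c : ℝ) (x : V) : V :=
  c • x + ((1 - c) * inner ℝ u x) • u

/-- The squared sine of the angle between `u` and the stretched vector `stretch u c x`. -/
noncomputable def defect (u : V) (c : ℝ) (x : V) : ℝ :=
  1 - inner ℝ u x ^ 2 / ‖stretch u c x‖ ^ 2

lemma stretch_add (u : V) (c : ℝ) (x y : V) :
    stretch u c (x + y) = stretch u c x + stretch u c y := by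
  simp only [stretch, inner_add_right, smul_add, mul_add, add_smul]; abel

lemma stretch_smul (u : V) (c a : ℝ) (x : V) : stretch u c (a • x) = a • stretch u c x := by
  simp only [stretch, inner_smul_right, smul_add, smul_smul]
  congr 2 <;> ring

lemma stretch_sum {ι : Type*} (u : V) (c : ℝ) (s : Finset ι) (f : ι → V) :
    stretch u c (∑ i ∈ s, f i) = ∑ i ∈ s, stretch u c (f i) := by
  simp only [stretch, inner_sum, Finset.smul_sum, Finset.mul_sum, Finset.sum_smul,
    Finset.sum_add_distrib]

lemma inner_stretch_stretch {u : V} (hu : ‖u‖ = 1) (c : ℝ) (a b : V) :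
    inner ℝ (stretch u c a) (stretch u c b)
      = c ^ 2 * inner ℝ a b + (1 - c ^ 2) * (inner ℝ u a * inner ℝ u b) := by
  have huu : inner ℝ u u = (1 : ℝ) := by rw [real_inner_self_eq_norm_sq, hu]; norm_num
  simp only [stretch, inner_add_left, inner_add_right, real_inner_smul_left,
    real_inner_smul_right, huu, real_inner_comm u a]
  ring

lemma inner_stretch_right {u : V} (hu : ‖u‖ = 1) (c : ℝ) (a : V) :
    inner ℝ u (stretch u c a) = inner ℝ u a := by
  have huu : inner ℝ u u = (1 : ℝ) := by rw [real_inner_self_eq_norm_sq, hu]; norm_num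
  simp only [stretch, inner_add_right, real_inner_smul_right, huu]
  ring

lemma norm_stretch_sq {u : V} (hu : ‖u‖ = 1) (c : ℝ) (a : V) :
    ‖stretch u c a‖ ^ 2 = inner ℝ u a ^ 2 + c ^ 2 * (‖a‖ ^ 2 - inner ℝ u a ^ 2) := by
  rw [← real_inner_self_eq_norm_sq, inner_stretch_stretch hu, real_inner_self_eq_norm_sq]
  ring

lemma inner_sq_le {u : V} (hu : ‖u‖ = 1) (a : V) : inner ℝ u a ^ 2 ≤ ‖a‖ ^ 2 := by
  have := abs_real_inner_le_norm u a
  rw [hu, one_mul] at this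
  exact sq_le_sq.2 (by rwa [abs_norm])

lemma defect_nonneg {u : V} (hu : ‖u‖ = 1) (c : ℝ) (a : V) : 0 ≤ defect u c a := by
  have h := inner_sq_le hu (stretch u c a)
  rw [inner_stretch_right hu] at h
  exact sub_nonneg.2 (div_le_one_of_le₀ h (sq_nonneg _))

lemma defect_le_one (u : V) (c : ℝ) (a : V) : defect u c a ≤ 1 :=
  sub_le_self _ (by positivity)

lemma norm_sub_smul_sq {u : V} (hu : ‖u‖ = 1) (c s : ℝ) (a : V) :
    ‖u - s • stretch u c a‖ ^ 2
      = 1 - 2 * s * inner ℝ u a + s ^ 2 * ‖stretch u c a‖ ^ 2 := by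
  rw [norm_sub_sq_real, real_inner_smul_right, inner_stretch_right hu, norm_smul, mul_pow, hu,
    Real.norm_eq_abs, sq_abs]
  ring

/-- The defect is the squared distance from `u` to the line spanned by the stretched vector, so any
point of that line bounds it. The free `s` lets the next step be bounded with the multiplier of the
current one. -/
lemma defect_le_norm_sub_sq {u : V} (hu : ‖u‖ = 1) (c s : ℝ) (a : V) :
    defect u c a ≤ ‖u - s • stretch u c a‖ ^ 2 := by
  rw [norm_sub_smul_sq hu, defect]
  have h := inner_sq_le hu (stretch u c a)
  rw [inner_stretch_right hu] at h
  set y := inner ℝ u a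
  -- If the stretched vector is zero, the quotient with denominator 0 is 0 and both sides equal 1.
  rcases (sq_nonneg ‖stretch u c a‖).eq_or_lt with h0 | h0
  · rw [← h0] at h ⊢
    have : y = 0 := by nlinarith
    simp [this]
  · set z := ‖stretch u c a‖ ^ 2
    have : 0 ≤ (y - s * z) ^ 2 / z := by positivity
    have h2 : (y - s * z) ^ 2 / z = y ^ 2 / z - 2 * s * y + s ^ 2 * z := by
      field_simp; ring
    linarith

/-- This multiplier is that of the orthogonal projection of `u`, so the bound
`defect_le_norm_sub_sq` is attained. -/
lemma norm_sub_sq_eq_defect {u : V} (hu : ‖u‖ = 1) (c : ℝ) (a : V) :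
    ‖u - (inner ℝ u a / ‖stretch u c a‖ ^ 2) • stretch u c a‖ ^ 2 = defect u c a := by
  rw [norm_sub_smul_sq hu, defect]
  field_simp
  ring

/-- The defect after a step in direction `e` of length `α + β`, where the part `β` is regarded
as an error. -/
lemma sqrt_defect_add_le {u : V} (hu : ‖u‖ = 1) (c s α β : ℝ) (a e : V) :
    √(defect u c (a + (α + β) • e)) ≤
      ‖(u - s • stretch u c a) - (s * α) • stretch u c e‖ + |s| * ‖stretch u c e‖ * |β| := by
  have h1 := Real.sqrt_le_sqrt (defect_le_norm_sub_sq hu c s (a + (α + β) • e))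
  rw [Real.sqrt_sq (norm_nonneg _)] at h1
  refine h1.trans ?_
  have h2 : u - s • stretch u c (a + (α + β) • e)
      = ((u - s • stretch u c a) - (s * α) • stretch u c e) - (s * β) • stretch u c e := by
    rw [stretch_add, stretch_smul]
    module
  rw [h2]
  refine (norm_sub_le _ _).trans (le_of_eq ?_)
  rw [norm_smul, Real.norm_eq_abs, abs_mul]
  ring

end Geometry

/-! ### Spectral bounds for the entries and columns of A. -/

section Spectral

variable {n : ℕ} {A : Matrix (Fin n) (Fin n) ℝ}
  {u : OrthonormalBasis (Fin n) ℝ (EuclideanSpace ℝ (Fin n))} {lam : Fin n → ℝ}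

lemma inner_toEuclideanLin (hA : A.IsSymm) (x y : EuclideanSpace ℝ (Fin n)) :
    inner ℝ x (Matrix.toEuclideanLin A y) = inner ℝ (Matrix.toEuclideanLin A x) y := by
  have h : (Matrix.toEuclideanLin A).IsSymmetric :=
    Matrix.isSymmetric_toEuclideanLin_iff.2 (by
      rw [Matrix.IsHermitian, Matrix.conjTranspose_eq_transpose_of_trivial]; exact hA)
  exact (h x y).symm

lemma inner_eigen (hA : A.IsSymm) (hu : IsOrderedEigenbasis A u lam) (k : Fin n)
    (x : EuclideanSpace ℝ (Fin n)) :
    inner ℝ (u k) (Matrix.toEuclideanLin A x) = lam k * inner ℝ (u k) x := by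
  rw [inner_toEuclideanLin hA, hu.eigen, real_inner_smul_left]

/-- Parseval for A e_j in the eigenbasis. -/
lemma sum_col_sq (hA : A.IsSymm) (hu : IsOrderedEigenbasis A u lam) (j : Fin n) :
    ∑ i, A i j ^ 2 = ∑ k, lam k ^ 2 * u k j ^ 2 := by
  have h1 : ‖Matrix.toEuclideanLin A (EuclideanSpace.single j 1)‖ ^ 2 = ∑ i, A i j ^ 2 := by
    rw [EuclideanSpace.norm_sq_eq]
    refine Finset.sum_congr rfl fun i _ => ?_
    rw [Real.norm_eq_abs, sq_abs]
    simp [Matrix.toEuclideanLin, Matrix.toLpLin]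
  rw [← h1, ← u.sum_sq_norm_inner_right]
  refine Finset.sum_congr rfl fun k _ => ?_
  rw [inner_eigen hA hu, Real.norm_eq_abs, sq_abs, mul_pow]
  simp [EuclideanSpace.inner_single_right]

lemma frobeniusNorm_sq (A : Matrix (Fin n) (Fin n) ℝ) :
    frobeniusNorm A ^ 2 = ∑ a, ∑ b, A a b ^ 2 :=
  Real.sq_sqrt (Finset.sum_nonneg fun _ _ => Finset.sum_nonneg fun _ _ => sq_nonneg _)

lemma sum_coord_sq (k : Fin n) : ∑ j, u k j ^ 2 = 1 := by
  have := EuclideanSpace.norm_sq_eq (u k)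
  simp only [u.norm_eq_one, Real.norm_eq_abs, sq_abs] at this
  linarith

lemma frobeniusNorm_sq_eq_sum_eigen (hA : A.IsSymm) (hu : IsOrderedEigenbasis A u lam) :
    frobeniusNorm A ^ 2 = ∑ k, lam k ^ 2 := by
  rw [frobeniusNorm_sq, Finset.sum_comm]
  simp_rw [sum_col_sq hA hu]
  rw [Finset.sum_comm]
  simp_rw [← Finset.mul_sum, sum_coord_sq, mul_one]

/-- Incoherence spreads the Frobenius norm evenly over the columns, up to the factor m². -/
lemma sum_col_sq_le (hA : A.IsSymm) (hu : IsOrderedEigenbasis A u lam) {m : ℝ}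
    (hm : Incoherent u m) (j : Fin n) :
    ∑ i, A i j ^ 2 ≤ m ^ 2 * frobeniusNorm A ^ 2 / n := by
  rw [sum_col_sq hA hu, frobeniusNorm_sq_eq_sum_eigen hA hu, mul_comm (m ^ 2), mul_div_assoc,
    Finset.sum_mul]
  exact Finset.sum_le_sum fun k _ => mul_le_mul_of_nonneg_left (hm j k) (sq_nonneg _)

lemma sum_col_abs_le (hA : A.IsSymm) (hu : IsOrderedEigenbasis A u lam) {m : ℝ} (hm0 : 0 ≤ m)
    (hm : Incoherent u m) (j : Fin n) : ∑ i, |A i j| ≤ m * frobeniusNorm A := by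
  have hn : (0 : ℝ) < n := by exact_mod_cast Fin.pos j
  have h1 : (∑ i, |A i j|) ^ 2 ≤ n * ∑ i, |A i j| ^ 2 := by
    simpa using sq_sum_le_card_mul_sum_sq (s := Finset.univ) (f := fun i => |A i j|)
  simp only [sq_abs] at h1
  have h2 := mul_le_mul_of_nonneg_left (sum_col_sq_le hA hu hm j) hn.le
  rw [mul_div_cancel₀ _ hn.ne'] at h2
  refine le_of_sq_le_sq ?_ (mul_nonneg hm0 (Real.sqrt_nonneg _))
  rw [mul_pow]; exact h1.trans h2

lemma abs_entry_le (hA : A.IsSymm) (hu : IsOrderedEigenbasis A u lam) {m : ℝ} (hm0 : 0 ≤ m)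
    (hm : Incoherent u m) (i j : Fin n) : |A i j| ≤ m * frobeniusNorm A / √n := by
  refine le_of_sq_le_sq ?_ (div_nonneg (mul_nonneg hm0 (Real.sqrt_nonneg _)) (Real.sqrt_nonneg _))
  rw [div_pow, Real.sq_sqrt (Nat.cast_nonneg n), mul_pow, sq_abs]
  exact (Finset.single_le_sum (fun i _ => sq_nonneg (A i j)) (Finset.mem_univ i)).trans
    (sum_col_sq_le hA hu hm j)

lemma inner_toEuclideanLin_self_le (hA : A.IsSymm) (hu : IsOrderedEigenbasis A u lam)
    {i₀ : Fin n} {l : ℝ} (hl : ∀ k, k ≠ i₀ → lam k ≤ l) (x : EuclideanSpace ℝ (Fin n)) :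
    inner ℝ x (Matrix.toEuclideanLin A x)
      ≤ lam i₀ * inner ℝ (u i₀) x ^ 2 + l * (‖x‖ ^ 2 - inner ℝ (u i₀) x ^ 2) := by
  rw [← u.sum_sq_norm_inner_right x, ← u.sum_inner_mul_inner x]
  simp_rw [inner_eigen hA hu, Real.norm_eq_abs, sq_abs]
  rw [← Finset.add_sum_erase _ _ (Finset.mem_univ i₀),
    ← Finset.add_sum_erase _ _ (Finset.mem_univ i₀), add_sub_cancel_left, Finset.mul_sum]
  refine add_le_add (le_of_eq ?_) (Finset.sum_le_sum fun k hk => ?_)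
  · rw [real_inner_comm]; ring
  · rw [real_inner_comm, mul_left_comm, ← sq]
    exact mul_le_mul_of_nonneg_right (hl k (Finset.ne_of_mem_erase hk)) (sq_nonneg _)

end Spectral

/-! ### Averages over the sampled entry. -/

section Average

variable {n : ℕ}

/-- The mean of `f i j` over all entries `(i, j)` of an `n × n` matrix. -/
noncomputable def entryAvg (f : Fin n → Fin n → ℝ) : ℝ := (∑ i, ∑ j, f i j) / (n : ℝ) ^ 2

lemma entryAvg_mono {f g : Fin n → Fin n → ℝ} (h : ∀ i j, f i j ≤ g i j) :
    entryAvg f ≤ entryAvg g :=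
  div_le_div_of_nonneg_right
    (Finset.sum_le_sum fun i _ => Finset.sum_le_sum fun j _ => h i j) (by positivity)

lemma entryAvg_add (f g : Fin n → Fin n → ℝ) :
    entryAvg (fun i j => f i j + g i j) = entryAvg f + entryAvg g := by
  simp only [entryAvg, Finset.sum_add_distrib, add_div]

lemma entryAvg_const_mul (c : ℝ) (f : Fin n → Fin n → ℝ) :
    entryAvg (fun i j => c * f i j) = c * entryAvg f := by
  simp only [entryAvg, ← Finset.mul_sum, mul_div_assoc]

lemma entryAvg_const (hn : n ≠ 0) (c : ℝ) : entryAvg (fun _ _ : Fin n => c) = c := by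
  have : (n : ℝ) ≠ 0 := by exact_mod_cast hn
  simp only [entryAvg, Finset.sum_const, Finset.card_univ, Fintype.card_fin, nsmul_eq_mul]
  field_simp

/-- The length of the step that Alecton takes along coordinate `i` when the entry `(i, j)` is
sampled and the vector `v` is read. -/
noncomputable def entryStep (A : Matrix (Fin n) (Fin n) ℝ) (η : ℝ)
    (v : EuclideanSpace ℝ (Fin n)) (i j : Fin n) : ℝ :=
  η * (n : ℝ) ^ 2 * A i j * v j

lemma increment_eq (A : Matrix (Fin n) (Fin n) ℝ) (η : ℝ) (i j : Fin n)
    (v : EuclideanSpace ℝ (Fin n)) :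
    increment A η i j v = entryStep A η v i j • EuclideanSpace.single i (1 : ℝ) := by
  ext k
  by_cases h : k = i <;> simp [increment, entryStep, h]

lemma entryStep_add (A : Matrix (Fin n) (Fin n) ℝ) (η : ℝ)
    (v w : EuclideanSpace ℝ (Fin n)) (i j : Fin n) :
    entryStep A η (v + w) i j = entryStep A η v i j + entryStep A η w i j := by
  simp only [entryStep, PiLp.add_apply]; ring

lemma entryAvg_abs_entryStep_le {A : Matrix (Fin n) (Fin n) ℝ} {η a : ℝ} (hη : 0 ≤ η)
    (ha : ∀ j, ∑ i, |A i j| ≤ a) (v : EuclideanSpace ℝ (Fin n)) :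
    entryAvg (fun i j => |entryStep A η v i j|) ≤ η * a * l1Norm v := by
  rcases Nat.eq_zero_or_pos n with rfl | hn
  · simp [entryAvg, l1Norm]
  have hn' : (0 : ℝ) < n := by exact_mod_cast hn
  rw [entryAvg, div_le_iff₀ (by positivity), Finset.sum_comm, l1Norm, Finset.mul_sum,
    Finset.sum_mul]
  refine Finset.sum_le_sum fun j _ => ?_
  have : ∑ i, |entryStep A η v i j| = η * (n : ℝ) ^ 2 * |v j| * ∑ i, |A i j| := by
    rw [Finset.mul_sum]
    refine Finset.sum_congr rfl fun i _ => ?_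
    rw [entryStep, abs_mul, abs_mul, abs_of_nonneg (by positivity : 0 ≤ η * (n : ℝ) ^ 2)]
    ring
  rw [this]
  calc _ ≤ η * (n : ℝ) ^ 2 * |v j| * a := mul_le_mul_of_nonneg_left (ha j) (by positivity)
    _ = _ := by ring

lemma entryAvg_entryStep_sq_le {A : Matrix (Fin n) (Fin n) ℝ} {η a : ℝ}
    (ha : ∀ j, ∑ i, A i j ^ 2 ≤ a) (v : EuclideanSpace ℝ (Fin n)) :
    entryAvg (fun i j => entryStep A η v i j ^ 2) ≤ η ^ 2 * (n : ℝ) ^ 2 * a * ‖v‖ ^ 2 := by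
  rcases Nat.eq_zero_or_pos n with rfl | hn
  · simp [entryAvg]
  have hn' : (0 : ℝ) < n := by exact_mod_cast hn
  rw [entryAvg, div_le_iff₀ (by positivity), Finset.sum_comm, EuclideanSpace.norm_sq_eq,
    Finset.mul_sum, Finset.sum_mul]
  refine Finset.sum_le_sum fun j _ => ?_
  have : ∑ i, entryStep A η v i j ^ 2 = η ^ 2 * (n : ℝ) ^ 4 * v j ^ 2 * ∑ i, A i j ^ 2 := by
    rw [Finset.mul_sum]
    refine Finset.sum_congr rfl fun i _ => ?_
    rw [entryStep]; ring
  rw [this, Real.norm_eq_abs, sq_abs]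
  calc _ ≤ η ^ 2 * (n : ℝ) ^ 4 * v j ^ 2 * a := mul_le_mul_of_nonneg_left (ha j) (by positivity)
    _ = _ := by ring

lemma toEuclideanLin_eq_sum (A : Matrix (Fin n) (Fin n) ℝ) (x : EuclideanSpace ℝ (Fin n)) :
    Matrix.toEuclideanLin A x
      = ∑ i, (∑ j, A i j * x j) • EuclideanSpace.single i (1 : ℝ) := by
  ext k
  simp [Matrix.toEuclideanLin, Matrix.toLpLin, Matrix.mulVec, dotProduct, Pi.single_apply]

/-- Unbiasedness: the factor n² of the update cancels the sampling probability, so the mean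
increment is η A x. -/
lemma entryAvg_entryStep_mul_inner (A : Matrix (Fin n) (Fin n) ℝ) (η : ℝ)
    (x b u : EuclideanSpace ℝ (Fin n)) (c : ℝ) :
    entryAvg (fun i j => entryStep A η x i j
        * inner ℝ b (stretch u c (EuclideanSpace.single i (1 : ℝ))))
      = η * inner ℝ b (stretch u c (Matrix.toEuclideanLin A x)) := by
  rcases Nat.eq_zero_or_pos n with rfl | hn
  · have : b = 0 := Subsingleton.elim _ _
    simp [entryAvg, this]
  have hn' : (n : ℝ) ≠ 0 := by exact_mod_cast hn.ne'
  rw [entryAvg, div_eq_iff (by positivity), toEuclideanLin_eq_sum, stretch_sum, inner_sum,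
    Finset.mul_sum, Finset.sum_mul]
  refine Finset.sum_congr rfl fun i _ => ?_
  rw [stretch_smul, real_inner_smul_right, Finset.sum_mul, Finset.mul_sum, Finset.sum_mul]
  refine Finset.sum_congr rfl fun j _ => ?_
  rw [entryStep]; ring

/-- One step of Alecton with a fresh read, in terms of a quadratic upper bound of the defect. -/
lemma entryAvg_norm_sub_sq_le {A : Matrix (Fin n) (Fin n) ℝ} (hn : n ≠ 0) {η a s M c : ℝ}
    {u : EuclideanSpace ℝ (Fin n)}
    (ha : ∀ j, ∑ i, A i j ^ 2 ≤ a)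
    (hM : ∀ i, ‖stretch u c (EuclideanSpace.single i (1 : ℝ))‖ ^ 2 ≤ M) (hM0 : 0 ≤ M)
    (b x : EuclideanSpace ℝ (Fin n)) :
    entryAvg (fun i j => ‖b - (s * entryStep A η x i j)
        • stretch u c (EuclideanSpace.single i (1 : ℝ))‖ ^ 2)
      ≤ ‖b‖ ^ 2 - 2 * s * (η * inner ℝ b (stretch u c (Matrix.toEuclideanLin A x)))
        + s ^ 2 * M * (η ^ 2 * (n : ℝ) ^ 2 * a * ‖x‖ ^ 2) := by
  have h1 : ∀ i j, ‖b - (s * entryStep A η x i j)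
        • stretch u c (EuclideanSpace.single i (1 : ℝ))‖ ^ 2
      ≤ (‖b‖ ^ 2 + (- 2 * s) * (entryStep A η x i j
          * inner ℝ b (stretch u c (EuclideanSpace.single i (1 : ℝ)))))
        + s ^ 2 * M * entryStep A η x i j ^ 2 := by
    intro i j
    rw [norm_sub_sq_real, real_inner_smul_right, norm_smul, mul_pow, Real.norm_eq_abs, sq_abs]
    have := mul_le_mul_of_nonneg_left (hM i) (sq_nonneg (s * entryStep A η x i j))
    nlinarith
  refine (entryAvg_mono h1).trans ?_
  rw [entryAvg_add, entryAvg_add, entryAvg_const hn, entryAvg_const_mul, entryAvg_const_mul,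
    entryAvg_entryStep_mul_inner]
  have := mul_le_mul_of_nonneg_left (entryAvg_entryStep_sq_le (η := η) ha x)
    (mul_nonneg (sq_nonneg s) hM0)
  linarith

end Average

/-! ### One step with a stale read, for general constants. -/

section Step

variable {n : ℕ} {A : Matrix (Fin n) (Fin n) ℝ}

/-- Averaged over the sampled entry, the defect after a step with a stale read exceeds the defect
before the step by at most a multiple of the staleness `w`. -/
lemma entryAvg_defect_le {η a s c b₀ φ : ℝ} {u x w : EuclideanSpace ℝ (Fin n)}
    (hu : ‖u‖ = 1) (hη : 0 ≤ η) (ha : ∀ j, ∑ i, |A i j| ≤ a) (hb₀ : 0 ≤ b₀)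
    (hs : ∀ i, |s| * ‖stretch u c (EuclideanSpace.single i (1 : ℝ))‖ ≤ b₀)
    (hφ : entryAvg (fun i j => ‖(u - s • stretch u c x) - (s * entryStep A η x i j)
        • stretch u c (EuclideanSpace.single i (1 : ℝ))‖ ^ 2) ≤ φ) :
    entryAvg (fun i j => defect u c (x + increment A η i j (x + w)))
      ≤ φ + 2 * b₀ * (η * a * l1Norm w) := by
  have h1 : ∀ i j, defect u c (x + increment A η i j (x + w))
      ≤ ‖(u - s • stretch u c x) - (s * entryStep A η x i j)
          • stretch u c (EuclideanSpace.single i (1 : ℝ))‖ ^ 2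
        + 2 * b₀ * |entryStep A η w i j| := by
    intro i j
    have h2 := sqrt_defect_add_le hu c s (entryStep A η x i j) (entryStep A η w i j) x
      (EuclideanSpace.single i (1 : ℝ))
    rw [← entryStep_add, ← increment_eq] at h2
    have h3 := mul_le_mul_of_nonneg_right (hs i) (abs_nonneg (entryStep A η w i j))
    have h4 := defect_nonneg hu c (x + increment A η i j (x + w))
    have h5 := defect_le_one u c (x + increment A η i j (x + w))
    have h6 := Real.sq_sqrt h4
    have h7 := Real.sqrt_nonneg (defect u c (x + increment A η i j (x + w)))
    have h8 : √(defect u c (x + increment A η i j (x + w))) ≤ 1 := Real.sqrt_le_one.2 h5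
    set q := √(defect u c (x + increment A η i j (x + w)))
    set p := ‖(u - s • stretch u c x) - (s * entryStep A η x i j)
          • stretch u c (EuclideanSpace.single i (1 : ℝ))‖
    have hp : 0 ≤ p := norm_nonneg _
    have hw : 0 ≤ b₀ * |entryStep A η w i j| := by positivity
    -- If q ≤ p, squaring suffices. Otherwise p ≤ q ≤ 1, so q² - p² ≤ 2(q - p): the bound q ≤ 1 is
    -- what avoids a term quadratic in the staleness.
    rcases le_total q p with hqp | hqp
    · nlinarith
    · nlinarith
  refine (entryAvg_mono h1).trans ?_
  rw [entryAvg_add, entryAvg_const_mul]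
  exact add_le_add hφ (mul_le_mul_of_nonneg_left (entryAvg_abs_entryStep_le hη ha w)
    (by positivity))

lemma l1Norm_nonneg (x : EuclideanSpace ℝ (Fin n)) : 0 ≤ l1Norm x :=
  Finset.sum_nonneg fun _ _ => abs_nonneg _

lemma l1Norm_add_le (x y : EuclideanSpace ℝ (Fin n)) :
    l1Norm (x + y) ≤ l1Norm x + l1Norm y := by
  rw [l1Norm, l1Norm, l1Norm, ← Finset.sum_add_distrib]
  exact Finset.sum_le_sum fun k _ => abs_add_le _ _

lemma abs_apply_le_l1Norm (x : EuclideanSpace ℝ (Fin n)) (k : Fin n) : |x k| ≤ l1Norm x :=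
  Finset.single_le_sum (f := fun k => |x k|) (fun _ _ => abs_nonneg _) (Finset.mem_univ k)

lemma norm_le_l1Norm (x : EuclideanSpace ℝ (Fin n)) : ‖x‖ ≤ l1Norm x := by
  refine le_of_sq_le_sq ?_ (l1Norm_nonneg x)
  rw [EuclideanSpace.norm_sq_eq, l1Norm]
  exact Finset.sum_sq_le_sq_sum_of_nonneg fun _ _ => abs_nonneg _

/-- Averaged over the sampled entry, the square root of the defect, weighted exponentially in the
length of the step, decreases up to a multiple of the staleness `w`. -/
lemma entryAvg_sqrt_defect_mul_exp_le {η a a₂ s c B φ d C k : ℝ}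
    {u x w : EuclideanSpace ℝ (Fin n)}
    (hu : ‖u‖ = 1) (hη : 0 ≤ η) (ha : ∀ j, ∑ i, |A i j| ≤ a) (ha₂ : ∀ j, ∑ i, A i j ^ 2 ≤ a₂)
    (ha₂0 : 0 ≤ a₂) (ha0 : 0 ≤ a)
    (hB : 0 ≤ B) (hφ : 0 ≤ φ) (hk : 0 ≤ k) (hx : 1 ≤ ‖x‖) (hxC : l1Norm x ≤ C)
    (hφ_eq : ‖u - s • stretch u c x‖ = φ)
    (hs : ∀ i, |s| * ‖stretch u c (EuclideanSpace.single i (1 : ℝ))‖ * ‖x‖ ≤ B * φ)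
    (hd : entryAvg (fun i j => ‖(u - s • stretch u c x) - (s * entryStep A η x i j)
        • stretch u c (EuclideanSpace.single i (1 : ℝ))‖) ≤ φ * (1 - d))
    (hkx : ∀ i j, k * |entryStep A η x i j| ≤ 1 / 50)
    (hkv : ∀ i j, k * |entryStep A η (x + w) i j| ≤ 1 / 50) :
    entryAvg (fun i j => √(defect u c (x + increment A η i j (x + w)))
        * Real.exp (k * |entryStep A η (x + w) i j|))
      ≤ φ * (1 - (d - 51 / 50 * k * C * (η * a + B * (η ^ 2 * (n : ℝ) ^ 2 * a₂)))
        + (21 / 20 * B * (η * a) + 51 / 50 * k * (η * a)) * l1Norm w) := by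
  have hx0 : 0 < ‖x‖ := by linarith
  have hBφ : 0 ≤ B * φ := by positivity
  have h1 : ∀ i j, √(defect u c (x + increment A η i j (x + w)))
        * Real.exp (k * |entryStep A η (x + w) i j|)
      ≤ ‖(u - s • stretch u c x) - (s * entryStep A η x i j)
          • stretch u c (EuclideanSpace.single i (1 : ℝ))‖
        + (21 / 20 * (B * φ) * |entryStep A η w i j|
        + (51 / 50 * k * φ * |entryStep A η (x + w) i j|
        + 51 / 50 * k * (B * φ) / ‖x‖ * entryStep A η x i j ^ 2)) := by
    intro i j
    have h2 := sqrt_defect_add_le hu c s (entryStep A η x i j) (entryStep A η w i j) x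
      (EuclideanSpace.single i (1 : ℝ))
    rw [← entryStep_add, ← increment_eq] at h2
    have hsi := (le_div_iff₀ hx0).2 (hs i)
    have hbx : B * φ / ‖x‖ ≤ B * φ := div_le_self hBφ hx
    have hbx0 : 0 ≤ B * φ / ‖x‖ := by positivity
    have h3 := mul_le_mul_of_nonneg_right (hsi.trans hbx) (abs_nonneg (entryStep A η w i j))
    have h4 : ‖(u - s • stretch u c x) - (s * entryStep A η x i j)
          • stretch u c (EuclideanSpace.single i (1 : ℝ))‖
        ≤ φ + B * φ / ‖x‖ * |entryStep A η x i j| := by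
      refine (norm_sub_le _ _).trans ?_
      rw [hφ_eq, norm_smul, Real.norm_eq_abs, abs_mul]
      have := mul_le_mul_of_nonneg_right hsi (abs_nonneg (entryStep A η x i j))
      linarith
    have hαv : |entryStep A η (x + w) i j| ≤ |entryStep A η x i j| + |entryStep A η w i j| := by
      rw [entryStep_add]; exact abs_add_le _ _
    have hkxi := hkx i j
    have hkvi := hkv i j
    rw [← sq_abs (entryStep A η x i j)]
    set αx := |entryStep A η x i j|
    set αw := |entryStep A η w i j|
    set αv := |entryStep A η (x + w) i j|
    have hαx0 : 0 ≤ αx := abs_nonneg _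
    have hαw0 : 0 ≤ αw := abs_nonneg _
    have hαv0 : 0 ≤ αv := abs_nonneg _
    set p := ‖(u - s • stretch u c x) - (s * entryStep A η x i j)
          • stretch u c (EuclideanSpace.single i (1 : ℝ))‖
    -- For 0 ≤ z ≤ 1/50, e^z ≤ 1 + z + z² and z² ≤ z/50.
    have hexp : Real.exp (k * αv) ≤ 1 + 51 / 50 * (k * αv) := by
      have h0 : 0 ≤ k * αv := by positivity
      have := (abs_le.1 (Real.abs_exp_sub_one_sub_id_le (x := k * αv)
        (by rw [abs_of_nonneg h0]; linarith))).2
      nlinarith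
    have hp0 : 0 ≤ p := norm_nonneg _
    calc _ ≤ (p + B * φ * αw) * (1 + 51 / 50 * (k * αv)) :=
          mul_le_mul (h2.trans (by linarith)) hexp (Real.exp_pos _).le (by positivity)
      _ = p + B * φ * αw + 51 / 50 * (k * αv) * p + 51 / 50 * (k * αv) * (B * φ * αw) := by ring
      _ ≤ p + B * φ * αw + 51 / 50 * (k * αv) * (φ + B * φ / ‖x‖ * αx)
          + 51 / 50 * (1 / 50) * (B * φ * αw) := by gcongr
      _ = p + B * φ * αw + 51 / 50 * k * φ * αv + 51 / 50 * k * (B * φ / ‖x‖) * αx * αv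
          + 51 / 50 * (1 / 50) * (B * φ * αw) := by ring
      _ ≤ p + B * φ * αw + 51 / 50 * k * φ * αv + 51 / 50 * k * (B * φ / ‖x‖) * αx * (αx + αw)
          + 51 / 50 * (1 / 50) * (B * φ * αw) := by gcongr
      _ = p + B * φ * αw + 51 / 50 * k * φ * αv + 51 / 50 * k * (B * φ) / ‖x‖ * αx ^ 2
          + 51 / 50 * (k * αx) * ((B * φ / ‖x‖) * αw)
          + 51 / 50 * (1 / 50) * (B * φ * αw) := by ring
      _ ≤ p + B * φ * αw + 51 / 50 * k * φ * αv + 51 / 50 * k * (B * φ) / ‖x‖ * αx ^ 2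
          + 51 / 50 * (1 / 50) * ((B * φ) * αw)
          + 51 / 50 * (1 / 50) * (B * φ * αw) := by gcongr
      -- The coefficients of Bφ·αw add up to 1 + 2·(51/50)/50 ≤ 21/20.
      _ ≤ _ := by
        have : 0 ≤ B * φ * αw := by positivity
        linarith
  refine (entryAvg_mono h1).trans ?_
  rw [entryAvg_add, entryAvg_add, entryAvg_add, entryAvg_const_mul, entryAvg_const_mul,
    entryAvg_const_mul]
  have e1 := mul_le_mul_of_nonneg_left (entryAvg_abs_entryStep_le hη ha w)
    (by positivity : 0 ≤ 21 / 20 * (B * φ))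
  have e2 : 51 / 50 * k * φ * entryAvg (fun i j => |entryStep A η (x + w) i j|)
      ≤ 51 / 50 * k * φ * (η * a * (C + l1Norm w)) := by
    refine mul_le_mul_of_nonneg_left ((entryAvg_abs_entryStep_le hη ha (x + w)).trans ?_)
      (by positivity)
    exact mul_le_mul_of_nonneg_left ((l1Norm_add_le x w).trans (by linarith)) (by positivity)
  -- The second moment of the step is of order ‖x‖²; the factor 1/‖x‖ leaves a single ‖x‖, which is
  -- at most C.
  have e3 : 51 / 50 * k * (B * φ) / ‖x‖ * entryAvg (fun i j => entryStep A η x i j ^ 2)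
      ≤ 51 / 50 * k * (B * φ) * (η ^ 2 * (n : ℝ) ^ 2 * a₂) * C := by
    calc _ ≤ 51 / 50 * k * (B * φ) / ‖x‖ * (η ^ 2 * (n : ℝ) ^ 2 * a₂ * ‖x‖ ^ 2) :=
          mul_le_mul_of_nonneg_left (entryAvg_entryStep_sq_le ha₂ x) (by positivity)
      _ = 51 / 50 * k * (B * φ) * (η ^ 2 * (n : ℝ) ^ 2 * a₂) * ‖x‖ := by field_simp
      _ ≤ _ := mul_le_mul_of_nonneg_left ((norm_le_l1Norm x).trans hxC) (by positivity)
  linarith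

end Step

/-! ### Parameter range and numerical estimates. -/

/-- The range of parameters in which one step of Alecton makes progress; `X` measures the
staleness of the reads. -/
structure Regime {n : ℕ} (A : Matrix (Fin n) (Fin n) ℝ)
    (u : OrthonormalBasis (Fin n) ℝ (EuclideanSpace ℝ (Fin n))) (lam : Fin n → ℝ) (i₀ : Fin n)
    (Δ m ε γ η C τ X : ℝ) : Prop where
  two_le : 2 ≤ n
  symm : A.IsSymm
  eigenbasis : IsOrderedEigenbasis A u lam
  gap : ∀ k, k ≠ i₀ → lam k ≤ lam i₀ - Δ
  gap_pos : 0 < Δ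
  gap_sq_le : Δ ^ 2 ≤ 2 * frobeniusNorm A ^ 2
  incoherent : Incoherent u m
  one_le_m : 1 ≤ m
  m_sq_le : m ^ 2 ≤ n
  ε_pos : 0 < ε
  ε_lt : ε < 1
  γ_pos : 0 < γ
  γ_le : γ ≤ 1 / 25
  η_pos : 0 < η
  step_size : 2 * η * n * m ^ 4 * frobeniusNorm A ^ 2 ≤ Δ * ε * γ
  staleness : 8 * η * n * m ^ 2 * frobeniusNorm A ^ 2 * C * τ ≤ Δ * √ε * γ * X
  one_le_C : 1 ≤ C
  τ_nonneg : 0 ≤ τ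
  X_nonneg : 0 ≤ X
  X_le : X ≤ 1

/-- The mean effect of one unit of staleness on the square root of the defect. -/
noncomputable def staleRate {n : ℕ} (A : Matrix (Fin n) (Fin n) ℝ) (m ε γ η : ℝ) : ℝ :=
  21 / 20 * (m / (√γ * √ε)) * (η * (m * frobeniusNorm A))

/-- The rate at which the potential is weighted by the writes that may still cause stale reads. -/
noncomputable def weightRate {n : ℕ} (A : Matrix (Fin n) (Fin n) ℝ) (m ε γ η : ℝ) : ℝ :=
  9 / 4 * staleRate A m ε γ η / √γ

namespace Regime

variable {n : ℕ} {A : Matrix (Fin n) (Fin n) ℝ}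
  {u : OrthonormalBasis (Fin n) ℝ (EuclideanSpace ℝ (Fin n))} {lam : Fin n → ℝ} {i₀ : Fin n}
  {Δ m ε γ η C τ X : ℝ}

lemma frobenius_pos (h : Regime A u lam i₀ Δ m ε γ η C τ X) : 0 < frobeniusNorm A := by
  have h1 := h.gap_sq_le
  have h2 : 0 < Δ ^ 2 := pow_pos h.gap_pos 2
  have h3 : 0 ≤ frobeniusNorm A := Real.sqrt_nonneg _
  rcases h3.eq_or_lt with h4 | h4
  · rw [← h4] at h1; norm_num at h1; exact absurd h1 h.gap_pos.ne'
  · exact h4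

lemma gap_le (h : Regime A u lam i₀ Δ m ε γ η C τ X) : Δ ≤ 3 / 2 * frobeniusNorm A := by
  have h1 := h.gap_sq_le
  have := h.frobenius_pos
  nlinarith

lemma staleRate_nonneg (h : Regime A u lam i₀ Δ m ε γ η C τ X) : 0 ≤ staleRate A m ε γ η := by
  have := h.frobenius_pos
  have := h.one_le_m
  have := h.η_pos
  unfold staleRate; positivity

lemma weightRate_nonneg (h : Regime A u lam i₀ Δ m ε γ η C τ X) : 0 ≤ weightRate A m ε γ η := by
  have := h.staleRate_nonneg
  unfold weightRate; positivity

lemma weightRate_eq (h : Regime A u lam i₀ Δ m ε γ η C τ X) :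
    weightRate A m ε γ η = 189 / 80 * (η * m ^ 2 * frobeniusNorm A) / (γ * √ε) := by
  have h1 := Real.sqrt_pos.2 h.γ_pos
  have h2 := Real.sqrt_pos.2 h.ε_pos
  have h3 := Real.sq_sqrt h.γ_pos.le
  rw [weightRate, staleRate]
  nth_rewrite 3 [← h3]
  field_simp
  ring

/-- The time scale on which the algorithm makes progress exceeds `n / (γ ε)`. -/
lemma progress_le (h : Regime A u lam i₀ Δ m ε γ η C τ X) : η * Δ * n * m ^ 4 ≤ ε * γ := by
  have hF := h.frobenius_pos
  have h1 := mul_le_mul_of_nonneg_left h.step_size h.gap_pos.le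
  have h2 := mul_le_mul_of_nonneg_left h.gap_sq_le (mul_pos h.ε_pos h.γ_pos).le
  have h3 : (η * Δ * n * m ^ 4) * (2 * frobeniusNorm A ^ 2)
      ≤ (ε * γ) * (2 * frobeniusNorm A ^ 2) := by linarith
  exact le_of_mul_le_mul_right h3 (by positivity)

/-- The staleness bound in terms of the weight rate. -/
lemma weight_mul_le (h : Regime A u lam i₀ Δ m ε γ η C τ X) :
    weightRate A m ε γ η * τ * C * (η * (m * frobeniusNorm A)) * n
      ≤ 189 / 640 * (η * Δ * m * X) := by
  have h1 := Real.sqrt_pos.2 h.ε_pos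
  have hγ := h.γ_pos
  rw [h.weightRate_eq]
  have h2 := mul_le_mul_of_nonneg_left h.staleness
    (by have := h.η_pos; have := h.one_le_m; positivity : 0 ≤ 189 / 640 * (η * m) / (γ * √ε))
  calc _ = 189 / 640 * (η * m) / (γ * √ε)
        * (8 * η * n * m ^ 2 * frobeniusNorm A ^ 2 * C * τ) := by ring
    _ ≤ _ := h2
    _ = _ := by field_simp

/-- Even the longest possible single write leaves the exponent of the weight small enough to
linearise the exponential. The entry bound costs √n, absorbed by the factor n in `progress_le`. -/
lemma weight_mul_step_le (h : Regime A u lam i₀ Δ m ε γ η C τ X)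
    {v : EuclideanSpace ℝ (Fin n)} (hv : ∀ k, |v k| ≤ C) (i j : Fin n) :
    weightRate A m ε γ η * τ * |entryStep A η v i j| ≤ 1 / 50 := by
  have hη := h.η_pos
  have hm := h.one_le_m
  have hC := h.one_le_C
  have hF := h.frobenius_pos
  have hκ := h.weightRate_nonneg
  have hτ := h.τ_nonneg
  have hn : (2 : ℝ) ≤ n := by exact_mod_cast h.two_le
  have hr : 1 ≤ √(n : ℝ) := Real.one_le_sqrt.2 (by linarith)
  have hr2 : √(n : ℝ) ^ 2 = n := Real.sq_sqrt (by linarith)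
  have h1 : |entryStep A η v i j| ≤ η * (n : ℝ) ^ 2 * (m * frobeniusNorm A / √n) * C := by
    rw [entryStep, abs_mul, abs_mul, abs_of_nonneg (by positivity : 0 ≤ η * (n : ℝ) ^ 2)]
    gcongr
    · exact abs_entry_le h.symm h.eigenbasis (by linarith) h.incoherent i j
    · exact hv j
  have h2 := h.progress_le
  have hηΔ : 0 < η * Δ := mul_pos hη h.gap_pos
  calc _ ≤ weightRate A m ε γ η * τ * (η * (n : ℝ) ^ 2 * (m * frobeniusNorm A / √n) * C) :=
        mul_le_mul_of_nonneg_left h1 (by positivity)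
    _ = (weightRate A m ε γ η * τ * C * (η * (m * frobeniusNorm A)) * n) * (n / √n) := by ring
    _ = (weightRate A m ε γ η * τ * C * (η * (m * frobeniusNorm A)) * n) * √n := by
        rw [Real.div_sqrt]
    _ ≤ 189 / 640 * (η * Δ * m * X) * √n := mul_le_mul_of_nonneg_right h.weight_mul_le (by positivity)
    _ ≤ 189 / 640 * (η * Δ * m * 1) * √n := by
        have := h.X_le; gcongr
    _ = 189 / 640 * (η * Δ) * (m * √n) := by ring
    _ ≤ 189 / 640 * (η * Δ) * (m ^ 4 * √n ^ 2) := by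
        gcongr
        · exact le_self_pow₀ hm (by norm_num)
        · exact le_self_pow₀ hr (by norm_num)
    _ = 189 / 640 * (η * Δ * n * m ^ 4) := by rw [hr2]; ring
    _ ≤ 189 / 640 * (1 * (1 / 25)) := by
        have := h.ε_lt; have := h.γ_le; have := h.γ_pos
        refine mul_le_mul_of_nonneg_left (h2.trans ?_) (by norm_num)
        gcongr
    _ ≤ _ := by norm_num

/-- The weight grows with each write, by τ times its length. This growth may consume only the share
X of the progress ηΔ/4. -/
lemma weight_loss_le (h : Regime A u lam i₀ Δ m ε γ η C τ X) :
    51 / 50 * (weightRate A m ε γ η * τ) * C * (η * (m * frobeniusNorm A)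
      + 21 / 20 * (m / (√γ * √ε)) * (η ^ 2 * (n : ℝ) ^ 2 * (m ^ 2 * frobeniusNorm A ^ 2 / n)))
      ≤ η * Δ * X / 4 := by
  have hη := h.η_pos
  have hm := h.one_le_m
  have hC := h.one_le_C
  have hF := h.frobenius_pos
  have hκ := h.weightRate_nonneg
  have hτ := h.τ_nonneg
  have hX := h.X_nonneg
  have hn : (2 : ℝ) ≤ n := by exact_mod_cast h.two_le
  have hηΔ : 0 < η * Δ := mul_pos hη h.gap_pos
  have hsε := Real.sqrt_pos.2 h.ε_pos
  have hsγ := Real.sqrt_pos.2 h.γ_pos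
  have hε2 := Real.sq_sqrt h.ε_pos.le
  have hγ2 := Real.sq_sqrt h.γ_pos.le
  have hsε1 : √ε ≤ 1 := Real.sqrt_le_one.2 h.ε_lt.le
  have hsγ1 : √γ ≤ 1 / 5 := Real.sqrt_le_iff.2 ⟨by norm_num, by linarith [h.γ_le]⟩
  have hw := h.weight_mul_le
  set W := weightRate A m ε γ η * τ * C * (η * (m * frobeniusNorm A)) with hW
  have hW0 : 0 ≤ W := by positivity
  -- From m² ≤ n ≤ n²/2.
  have hmn : m ≤ 71 / 100 * n := by
    refine le_of_sq_le_sq ?_ (by positivity)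
    have := h.m_sq_le
    nlinarith
  have h1 : W ≤ 189 / 640 * (71 / 100) * (η * Δ * X) := by
    have : W * n ≤ 189 / 640 * (71 / 100) * (η * Δ * X) * n := by
      refine hw.trans ?_
      have : η * Δ * X * m ≤ η * Δ * X * (71 / 100 * n) :=
        mul_le_mul_of_nonneg_left hmn (by positivity)
      linarith
    exact le_of_mul_le_mul_right this (by linarith)
  have h2 : η * m ^ 3 * frobeniusNorm A ≤ 3 / 8 * (ε * γ) := by
    have e1 : (2 * η * n * m ^ 4 * frobeniusNorm A) * frobeniusNorm A
        ≤ (3 / 2 * (ε * γ)) * frobeniusNorm A := by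
      have := h.step_size
      have e2 := mul_le_mul_of_nonneg_right h.gap_le (mul_pos h.ε_pos h.γ_pos).le
      linarith
    have e3 := le_of_mul_le_mul_right e1 hF
    have e4 : 2 * η * 2 * (m ^ 3 * 1) * frobeniusNorm A
        ≤ 2 * η * n * (m ^ 3 * m) * frobeniusNorm A := by gcongr
    linarith
  have h3 : weightRate A m ε γ η * τ * C * (21 / 20 * (m / (√γ * √ε))
      * (η ^ 2 * (n : ℝ) ^ 2 * (m ^ 2 * frobeniusNorm A ^ 2 / n))) ≤
      189 / 640 * (21 / 20) * (3 / 40) * (η * Δ * X) := by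
    calc _ = 21 / 20 / (√γ * √ε) * (η * m ^ 2 * frobeniusNorm A) * (W * n) := by
          rw [hW]; field_simp
      _ ≤ 21 / 20 / (√γ * √ε) * (η * m ^ 2 * frobeniusNorm A)
          * (189 / 640 * (η * Δ * m * X)) := mul_le_mul_of_nonneg_left hw (by positivity)
      _ = 189 / 640 * (21 / 20) * (η * Δ * X) / (√γ * √ε) * (η * m ^ 3 * frobeniusNorm A) := by
          field_simp
      _ ≤ 189 / 640 * (21 / 20) * (η * Δ * X) / (√γ * √ε) * (3 / 8 * (ε * γ)) :=
          mul_le_mul_of_nonneg_left h2 (by positivity)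
      _ = 189 / 640 * (21 / 20) * (η * Δ * X) * (3 / 8 * (√ε * √γ)) := by
          nth_rewrite 2 [← hε2]; nth_rewrite 2 [← hγ2]; field_simp
      _ ≤ 189 / 640 * (21 / 20) * (η * Δ * X) * (3 / 8 * (1 * (1 / 5))) := by gcongr
      _ = _ := by ring
  have hfin : 51 / 50 * (weightRate A m ε γ η * τ) * C * (η * (m * frobeniusNorm A)
      + 21 / 20 * (m / (√γ * √ε)) * (η ^ 2 * (n : ℝ) ^ 2 * (m ^ 2 * frobeniusNorm A ^ 2 / n)))
      = 51 / 50 * (W + weightRate A m ε γ η * τ * C * (21 / 20 * (m / (√γ * √ε))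
      * (η ^ 2 * (n : ℝ) ^ 2 * (m ^ 2 * frobeniusNorm A ^ 2 / n)))) := by rw [hW]; ring
  rw [hfin]
  have : 0 ≤ η * Δ * X := by positivity
  linarith

/-- The factor 9/4 in `weightRate` splits as 2 + 1/4: the part 2 is reserved to offset the growth of
the unweighted defect, and the part 1/4 covers the stale error of the weighted one, since √γ ≤ 1/5
makes the left side at most 0.22 times `staleRate`/√γ. -/
lemma stale_le_weight (h : Regime A u lam i₀ Δ m ε γ η C τ X) :
    21 / 20 * (21 / 20 * (m / (√γ * √ε))) * (η * (m * frobeniusNorm A))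
      + 51 / 50 * (weightRate A m ε γ η * τ) * (η * (m * frobeniusNorm A))
      ≤ weightRate A m ε γ η - 2 * staleRate A m ε γ η / √γ := by
  have hη := h.η_pos
  have hm := h.one_le_m
  have hF := h.frobenius_pos
  have hκ := h.weightRate_nonneg
  have hK := h.staleRate_nonneg
  have hτ := h.τ_nonneg
  have hn : (2 : ℝ) ≤ n := by exact_mod_cast h.two_le
  have hsγ := Real.sqrt_pos.2 h.γ_pos
  have hsγ1 : √γ ≤ 1 / 5 := Real.sqrt_le_iff.2 ⟨by norm_num, by linarith [h.γ_le]⟩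
  have hsε1 : √ε ≤ 1 := Real.sqrt_le_one.2 h.ε_lt.le
  have h1 : τ * (η * (m * frobeniusNorm A)) ≤ 3 / 800 := by
    have e1 : (8 * η * n * m ^ 2 * frobeniusNorm A * τ) * frobeniusNorm A
        ≤ (3 / 50) * frobeniusNorm A := by
      calc _ = 8 * η * n * m ^ 2 * frobeniusNorm A ^ 2 * 1 * τ := by ring
        _ ≤ 8 * η * n * m ^ 2 * frobeniusNorm A ^ 2 * C * τ := by
            have := h.one_le_C; gcongr
        _ ≤ Δ * √ε * γ * X := h.staleness
        _ ≤ (3 / 2 * frobeniusNorm A) * 1 * (1 / 25) * 1 := by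
            have := h.gap_le; have := h.γ_le; have := h.X_le; have := h.X_nonneg
            have := h.γ_pos
            gcongr
        _ = _ := by ring
    have e2 := le_of_mul_le_mul_right e1 hF
    have e3 : 8 * η * 2 * (m * 1) * frobeniusNorm A * τ
        ≤ 8 * η * n * (m * m) * frobeniusNorm A * τ := by gcongr
    nlinarith
  have h2 : 21 / 20 * (21 / 20 * (m / (√γ * √ε))) * (η * (m * frobeniusNorm A))
      = 21 / 20 * staleRate A m ε γ η := by rw [staleRate]; ring
  have h3 : staleRate A m ε γ η ≤ 1 / 5 * (staleRate A m ε γ η / √γ) := by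
    rw [← mul_div_assoc, le_div_iff₀ hsγ, mul_comm]
    exact mul_le_mul_of_nonneg_right hsγ1 hK
  have h4 : weightRate A m ε γ η = 9 / 4 * (staleRate A m ε γ η / √γ) := by
    rw [weightRate]; ring
  have h5 := mul_le_mul_of_nonneg_left h1 hκ
  have h6 : 0 ≤ staleRate A m ε γ η / √γ := by positivity
  rw [h2, mul_div_assoc]
  rw [h4] at h5 ⊢
  nlinarith

/-- Geometry of a state outside the success set. -/
lemma state_bounds (h : Regime A u lam i₀ Δ m ε γ η C τ X) {x : EuclideanSpace ℝ (Fin n)}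
    (hx : 1 ≤ ‖x‖) (hxS : x ∉ successSet (u i₀) ε) {θ s : ℝ}
    (hθ : θ = defect (u i₀) (√(γ / n)) x)
    (hs : s = inner ℝ (u i₀) x / ‖stretch (u i₀) (√(γ / n)) x‖ ^ 2) :
    0 < ‖stretch (u i₀) (√(γ / n)) x‖ ^ 2 ∧ γ * ε / n ≤ θ ∧
      s * inner ℝ (u i₀) x = 1 - θ ∧
      s ^ 2 * (γ / n * (‖x‖ ^ 2 - inner ℝ (u i₀) x ^ 2)) = (1 - θ) * θ ∧
      s ^ 2 * ‖x‖ ^ 2 ≤ (1 - θ) * θ * (n / (γ * ε)) := by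
  have hn : (2 : ℝ) ≤ n := by exact_mod_cast h.two_le
  have hγ := h.γ_pos
  have hε := h.ε_pos
  have hg : 0 < γ / n := by positivity
  have hg1 : γ / n ≤ 1 := by
    rw [div_le_one (by linarith)]; linarith [h.γ_le]
  have hz := norm_stretch_sq (u.norm_eq_one i₀) (√(γ / n)) x
  rw [Real.sq_sqrt hg.le] at hz
  simp only [successSet, Set.mem_ofPred_eq, ge_iff_le, not_le] at hxS
  rw [defect, hz] at hθ
  rw [hz] at hs ⊢
  set y := inner ℝ (u i₀) x
  set q := ‖x‖ ^ 2
  set g := γ / n with hgdef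
  have hq : 1 ≤ q := one_le_pow₀ hx
  have hρ : ε * q ≤ q - y ^ 2 := by linarith
  have hρ0 : 0 < q - y ^ 2 := lt_of_lt_of_le (by positivity) hρ
  have hzpos : 0 < y ^ 2 + g * (q - y ^ 2) := by positivity
  set z := y ^ 2 + g * (q - y ^ 2) with hzdef
  have hθ' : θ = g * (q - y ^ 2) / z := by rw [hθ, hzdef]; field_simp; ring
  have h1θ : 1 - θ = y ^ 2 / z := by rw [hθ]; ring
  have hsy : s * y = 1 - θ := by rw [h1θ, hs]; ring
  have hsρ : s ^ 2 * (g * (q - y ^ 2)) = (1 - θ) * θ := by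
    rw [h1θ, hθ', hs]; field_simp
  refine ⟨hzpos, ?_, hsy, hsρ, ?_⟩
  · rw [hθ', le_div_iff₀ hzpos]
    have hzq : z ≤ q := by rw [hzdef]; nlinarith
    calc γ * ε / n * z = g * (ε * z) := by rw [hgdef]; ring
      _ ≤ g * (ε * q) := by gcongr
      _ ≤ _ := by gcongr
  · rw [← hsρ]
    calc s ^ 2 * q = s ^ 2 * (g * (ε * q)) * (n / (γ * ε)) := by rw [hgdef]; field_simp
      _ ≤ _ := by gcongr

/-- Incoherence bounds the component along `u i₀`; shrinking reduces the complement to at most γ/n ≤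
m²/(10n). -/
lemma norm_stretch_single_sq_le (h : Regime A u lam i₀ Δ m ε γ η C τ X) (i : Fin n) :
    ‖stretch (u i₀) (√(γ / n)) (EuclideanSpace.single i (1 : ℝ))‖ ^ 2
      ≤ 11 / 10 * m ^ 2 / n := by
  have hn : (2 : ℝ) ≤ n := by exact_mod_cast h.two_le
  have hg : 0 < γ / n := div_pos h.γ_pos (by linarith)
  rw [norm_stretch_sq (u.norm_eq_one i₀), Real.sq_sqrt hg.le]
  have h1 : inner ℝ (u i₀) (EuclideanSpace.single i (1 : ℝ)) = u i₀ i := by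
    simp [EuclideanSpace.inner_single_right]
  rw [h1, PiLp.norm_single, norm_one]
  have h2 := h.incoherent i i₀
  have h3 : γ / n ≤ 1 / 10 * m ^ 2 / n := by
    gcongr
    have := one_le_pow₀ (n := 2) h.one_le_m
    linarith [h.γ_le]
  have h4 : 0 ≤ γ / n * u i₀ i ^ 2 := by positivity
  have h5 : 11 / 10 * m ^ 2 / n = m ^ 2 / n + 1 / 10 * m ^ 2 / n := by ring
  linarith

end Regime

/-! ### Drift of the defect outside the success set. -/

namespace Regime

variable {n : ℕ} {A : Matrix (Fin n) (Fin n) ℝ}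
  {u : OrthonormalBasis (Fin n) ℝ (EuclideanSpace ℝ (Fin n))} {lam : Fin n → ℝ} {i₀ : Fin n}
  {Δ m ε γ η C τ X : ℝ}

/-- Being proportional to √θ, this bound turns the stale error in √θ into a relative one. It
combines s²‖x‖² ≤ (1-θ)θ·n/(γε) with incoherence, using 11/10 ≤ (21/20)². -/
lemma abs_mul_norm_stretch_single_le (h : Regime A u lam i₀ Δ m ε γ η C τ X)
    {x : EuclideanSpace ℝ (Fin n)} (hx : 1 ≤ ‖x‖) (hxS : x ∉ successSet (u i₀) ε) (i : Fin n) :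
    |inner ℝ (u i₀) x / ‖stretch (u i₀) (√(γ / n)) x‖ ^ 2|
      * ‖stretch (u i₀) (√(γ / n)) (EuclideanSpace.single i (1 : ℝ))‖ * ‖x‖
      ≤ 21 / 20 * (m / (√γ * √ε)) * √(defect (u i₀) (√(γ / n)) x) := by
  obtain ⟨-, -, -, -, h1⟩ := h.state_bounds hx hxS rfl rfl
  have h2 := h.norm_stretch_single_sq_le i
  have hθ0 := defect_nonneg (u.norm_eq_one i₀) (√(γ / n)) x
  have hn : (2 : ℝ) ≤ n := by exact_mod_cast h.two_le
  have hm := h.one_le_m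
  have hγ := h.γ_pos
  have hε := h.ε_pos
  refine le_of_sq_le_sq ?_ (by positivity)
  set θ := defect (u i₀) (√(γ / n)) x
  set s := inner ℝ (u i₀) x / ‖stretch (u i₀) (√(γ / n)) x‖ ^ 2
  calc _ = s ^ 2 * ‖x‖ ^ 2
        * ‖stretch (u i₀) (√(γ / n)) (EuclideanSpace.single i (1 : ℝ))‖ ^ 2 := by
        rw [mul_pow, mul_pow, sq_abs]; ring
    _ ≤ s ^ 2 * ‖x‖ ^ 2 * (11 / 10 * m ^ 2 / n) := by gcongr
    _ ≤ (1 - θ) * θ * (n / (γ * ε)) * (11 / 10 * m ^ 2 / n) := by gcongr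
    _ = 11 / 10 * (m ^ 2 / (γ * ε)) * ((1 - θ) * θ) := by field_simp
    _ ≤ 11 / 10 * (m ^ 2 / (γ * ε)) * (1 * θ) := by gcongr; linarith
    _ ≤ (21 / 20) ^ 2 * (m ^ 2 / (γ * ε)) * θ := by
        have : 0 ≤ m ^ 2 / (γ * ε) * θ := by positivity
        linarith
    _ = _ := by
        rw [mul_pow, mul_pow (21 / 20 : ℝ), div_pow m, mul_pow (√γ), Real.sq_sqrt hγ.le,
          Real.sq_sqrt hε.le, Real.sq_sqrt hθ0]

/-- With a fresh read, the mean defect decreases. -/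
lemma entryAvg_fresh_le (h : Regime A u lam i₀ Δ m ε γ η C τ X)
    {x : EuclideanSpace ℝ (Fin n)} (hx : 1 ≤ ‖x‖) (hxS : x ∉ successSet (u i₀) ε) {s : ℝ}
    (hs : s = inner ℝ (u i₀) x / ‖stretch (u i₀) (√(γ / n)) x‖ ^ 2)
    (hθ : defect (u i₀) (√(γ / n)) x ≤ 1 / 2) :
    entryAvg (fun i j => ‖(u i₀ - s • stretch (u i₀) (√(γ / n)) x) - (s * entryStep A η x i j)
        • stretch (u i₀) (√(γ / n)) (EuclideanSpace.single i (1 : ℝ))‖ ^ 2)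
      ≤ defect (u i₀) (√(γ / n)) x * (1 - 29 / 40 * (η * Δ)) := by
  obtain ⟨hz, -, hsy, hsρ, hsq⟩ := h.state_bounds hx hxS rfl hs
  have hθ0 := defect_nonneg (u.norm_eq_one i₀) (√(γ / n)) x
  have hθ_eq := norm_sub_sq_eq_defect (u.norm_eq_one i₀) (√(γ / n)) x
  rw [← hs] at hθ_eq
  have hn : (2 : ℝ) ≤ n := by exact_mod_cast h.two_le
  have hγ := h.γ_pos
  have hε := h.ε_pos
  have hη := h.η_pos
  have hΔ := h.gap_pos
  have hg : 0 < γ / n := by positivity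
  have hu := u.norm_eq_one i₀
  have h1 := entryAvg_norm_sub_sq_le (A := A) (η := η) (s := s)
    (by have := h.two_le; omega : n ≠ 0)
    (sum_col_sq_le h.symm h.eigenbasis h.incoherent) h.norm_stretch_single_sq_le (by positivity)
    (u i₀ - s • stretch (u i₀) (√(γ / n)) x) x
  rw [hθ_eq] at h1
  refine h1.trans ?_
  have h2 := inner_toEuclideanLin_self_le h.symm h.eigenbasis h.gap x
  have h3 : inner ℝ (u i₀ - s • stretch (u i₀) (√(γ / n)) x)
        (stretch (u i₀) (√(γ / n)) (Matrix.toEuclideanLin A x))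
      = lam i₀ * inner ℝ (u i₀) x - s * (γ / n * inner ℝ x (Matrix.toEuclideanLin A x)
        + (1 - γ / n) * (inner ℝ (u i₀) x * (lam i₀ * inner ℝ (u i₀) x))) := by
    rw [inner_sub_left, real_inner_smul_left, inner_stretch_stretch hu, inner_stretch_right hu,
      inner_eigen h.symm h.eigenbasis, Real.sq_sqrt hg.le]
  rw [h3]
  set θ := defect (u i₀) (√(γ / n)) x
  set y := inner ℝ (u i₀) x
  -- First-order gain: expressed through s·y = 1 - θ, all terms with `lam i₀` cancel and only the
  -- gap remains.
  have h4 : Δ * ((1 - θ) * θ) ≤ s * (lam i₀ * y - s * (γ / n * inner ℝ x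
      (Matrix.toEuclideanLin A x) + (1 - γ / n) * (y * (lam i₀ * y)))) := by
    have e1 := mul_le_mul_of_nonneg_left h2 (by positivity : 0 ≤ s ^ 2 * (γ / n))
    have e2 : s ^ 2 * (γ / n) * (lam i₀ * y ^ 2 + (lam i₀ - Δ) * (‖x‖ ^ 2 - y ^ 2))
        = γ / n * lam i₀ * (s * y) ^ 2
          + (lam i₀ - Δ) * (s ^ 2 * (γ / n * (‖x‖ ^ 2 - y ^ 2))) := by ring
    rw [e2, hsρ, hsy] at e1
    have e3 : s * (lam i₀ * y - s * (γ / n * inner ℝ x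
      (Matrix.toEuclideanLin A x) + (1 - γ / n) * (y * (lam i₀ * y))))
      = lam i₀ * (s * y) - (1 - γ / n) * lam i₀ * (s * y) ^ 2
        - s ^ 2 * (γ / n) * inner ℝ x (Matrix.toEuclideanLin A x) := by ring
    rw [e3, hsy]
    linarith
  have h5 : s ^ 2 * (11 / 10 * m ^ 2 / n) * (η ^ 2 * (n : ℝ) ^ 2
      * (m ^ 2 * frobeniusNorm A ^ 2 / n) * ‖x‖ ^ 2) ≤ 11 / 20 * (η * Δ) * ((1 - θ) * θ) := by
    have hm := h.one_le_m
    calc _ = 11 / 20 * η * (2 * η * n * m ^ 4 * frobeniusNorm A ^ 2) / n * (s ^ 2 * ‖x‖ ^ 2) := by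
          field_simp; ring
      _ ≤ 11 / 20 * η * (Δ * ε * γ) / n * ((1 - θ) * θ * (n / (γ * ε))) := by
          have := h.step_size
          gcongr
      _ = _ := by field_simp
  -- The net rate is 2 - 11/20 = 29/20 times (1-θ)θ, and θ ≤ 1/2 turns it into 29/40 times θ.
  have h6 : 1 / 2 * θ ≤ (1 - θ) * θ := by gcongr; linarith
  have h7 := mul_le_mul_of_nonneg_left h6 (mul_pos hη hΔ).le
  have h8 := mul_le_mul_of_nonneg_left h4 hη.le
  nlinarith

/-- The mean defect after one step with the stale read `x + w`. -/
lemma entryAvg_defect_step_le (h : Regime A u lam i₀ Δ m ε γ η C τ X)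
    {x w : EuclideanSpace ℝ (Fin n)} (hx : 1 ≤ ‖x‖) (hxS : x ∉ successSet (u i₀) ε)
    (hθ : defect (u i₀) (√(γ / n)) x ≤ 1 / 2) :
    entryAvg (fun i j => defect (u i₀) (√(γ / n)) (x + increment A η i j (x + w)))
      ≤ defect (u i₀) (√(γ / n)) x
        + 2 * staleRate A m ε γ η * √(defect (u i₀) (√(γ / n)) x) * l1Norm w := by
  have hθ0 := defect_nonneg (u.norm_eq_one i₀) (√(γ / n)) x
  have hm := h.one_le_m
  have hp : 0 ≤ 29 / 40 * (η * Δ) := by have := h.η_pos; have := h.gap_pos; positivity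
  refine (entryAvg_defect_le (u.norm_eq_one i₀) h.η_pos.le
    (sum_col_abs_le h.symm h.eigenbasis (by linarith) h.incoherent)
    (b₀ := 21 / 20 * (m / (√γ * √ε)) * √(defect (u i₀) (√(γ / n)) x)) (by positivity)
    (fun i => ?_) ((h.entryAvg_fresh_le hx hxS rfl hθ).trans
      (mul_le_of_le_one_right hθ0 (by linarith)))).trans (le_of_eq ?_)
  · exact (le_mul_of_one_le_right (by positivity) hx).trans
      (h.abs_mul_norm_stretch_single_le hx hxS i)
  · rw [staleRate]; ring

/-- The mean square root of the defect after one step with the stale read `x + w`, weighted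
exponentially in the length of the step. -/
lemma entryAvg_sqrt_defect_step_le (h : Regime A u lam i₀ Δ m ε γ η C τ X)
    {x w : EuclideanSpace ℝ (Fin n)} (hx : 1 ≤ ‖x‖) (hxC : l1Norm x ≤ C)
    (hv : ∀ k, |(x + w) k| ≤ C) (hxS : x ∉ successSet (u i₀) ε)
    (hθ : defect (u i₀) (√(γ / n)) x ≤ 1 / 2) :
    entryAvg (fun i j => √(defect (u i₀) (√(γ / n)) (x + increment A η i j (x + w)))
        * Real.exp (weightRate A m ε γ η * τ * |entryStep A η (x + w) i j|))
      ≤ √(defect (u i₀) (√(γ / n)) x) * (1 - η * Δ / 4 * (1 - X)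
        + (weightRate A m ε γ η - 2 * staleRate A m ε γ η / √γ) * l1Norm w) := by
  have hu := u.norm_eq_one i₀
  have hθ0 := defect_nonneg hu (√(γ / n)) x
  have hm := h.one_le_m
  have hF := h.frobenius_pos
  obtain ⟨hz, hθpos, -, -, -⟩ := h.state_bounds hx hxS rfl rfl
  have hθ_eq := norm_sub_sq_eq_defect hu (√(γ / n)) x
  have hfresh := h.entryAvg_fresh_le hx hxS rfl hθ
  have hn : (2 : ℝ) ≤ n := by exact_mod_cast h.two_le
  have hφ : 0 < √(defect (u i₀) (√(γ / n)) x) := by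
    refine Real.sqrt_pos.2 (lt_of_lt_of_le ?_ hθpos)
    have := h.γ_pos
    have := h.ε_pos
    positivity
  set s := inner ℝ (u i₀) x / ‖stretch (u i₀) (√(γ / n)) x‖ ^ 2 with hs
  set θ := defect (u i₀) (√(γ / n)) x with hθdef
  set φ := √θ with hφdef
  have hφ2 : φ ^ 2 = θ := Real.sq_sqrt hθ0
  have hd : entryAvg (fun i j => ‖(u i₀ - s • stretch (u i₀) (√(γ / n)) x)
      - (s * entryStep A η x i j)
        • stretch (u i₀) (√(γ / n)) (EuclideanSpace.single i (1 : ℝ))‖)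
      ≤ φ * (1 - 29 / 80 * (η * Δ)) := by
    -- The tangent of the square root at φ², that is p ≤ p²/(2φ) + φ/2, transfers the contraction to
    -- the unsquared distance at half the rate.
    have h1 : ∀ i j, ‖(u i₀ - s • stretch (u i₀) (√(γ / n)) x)
      - (s * entryStep A η x i j)
        • stretch (u i₀) (√(γ / n)) (EuclideanSpace.single i (1 : ℝ))‖
        ≤ 1 / (2 * φ) * ‖(u i₀ - s • stretch (u i₀) (√(γ / n)) x)
      - (s * entryStep A η x i j)
        • stretch (u i₀) (√(γ / n)) (EuclideanSpace.single i (1 : ℝ))‖ ^ 2 + φ / 2 := by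
      intro i j
      set p := ‖(u i₀ - s • stretch (u i₀) (√(γ / n)) x)
      - (s * entryStep A η x i j)
        • stretch (u i₀) (√(γ / n)) (EuclideanSpace.single i (1 : ℝ))‖
      have : 1 / (2 * φ) * p ^ 2 + φ / 2 - p = (p - φ) ^ 2 / (2 * φ) := by field_simp; ring
      have : 0 ≤ (p - φ) ^ 2 / (2 * φ) := by positivity
      linarith
    refine (entryAvg_mono h1).trans ?_
    rw [entryAvg_add, entryAvg_const_mul, entryAvg_const (by have := h.two_le; omega)]
    have h2 := mul_le_mul_of_nonneg_left hfresh (by positivity : 0 ≤ 1 / (2 * φ))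
    refine (add_le_add_left h2 _).trans (le_of_eq ?_)
    rw [← hφ2]; field_simp; ring
  have hmain := entryAvg_sqrt_defect_mul_exp_le (A := A) (w := w) hu h.η_pos.le
    (sum_col_abs_le h.symm h.eigenbasis (by linarith) h.incoherent)
    (sum_col_sq_le h.symm h.eigenbasis h.incoherent) (by positivity) (by positivity)
    (B := 21 / 20 * (m / (√γ * √ε))) (by positivity) hφ.le
    (mul_nonneg h.weightRate_nonneg h.τ_nonneg) hx hxC
    (by rw [hφdef, ← hθ_eq, Real.sqrt_sq (norm_nonneg _)])
    (h.abs_mul_norm_stretch_single_le hx hxS) hd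
    (h.weight_mul_step_le fun k => (abs_apply_le_l1Norm x k).trans hxC) (h.weight_mul_step_le hv)
  refine hmain.trans (mul_le_mul_of_nonneg_left ?_ hφ.le)
  -- The rate 29/80 exceeds the 1/4 claimed, and the loss removes the share X of that 1/4.
  have e1 := h.weight_loss_le
  have e2 := mul_le_mul_of_nonneg_right h.stale_le_weight (l1Norm_nonneg w)
  have e3 : 0 < η * Δ := mul_pos h.η_pos h.gap_pos
  linarith

end Regime

/-! ### Accounting for staleness along a path. -/

section Path

variable {n : ℕ}

/-- The length of write `s` in the 1-norm. -/
noncomputable def writeLength (ξ : ℕ → EuclideanSpace ℝ (Fin n)) (s : ℕ) : ℝ :=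
  l1Norm (ξ (s + 1) - ξ s)

/-- The mean staleness of the vector read at step `t`, when `p d` bounds the probability of a delay
of at least `d`. -/
noncomputable def meanStaleness (p : ℕ → ℝ) (ξ : ℕ → EuclideanSpace ℝ (Fin n)) (t : ℕ) : ℝ :=
  ∑ s ∈ Finset.range t, p (t - s) * writeLength ξ s

/-- The total mean staleness that the writes before step `t` may still cause at the steps from `t`
on. -/
noncomputable def pendingStaleness (p : ℕ → ℝ) (τ : ℝ) (ξ : ℕ → EuclideanSpace ℝ (Fin n))
    (t : ℕ) : ℝ :=
  ∑ s ∈ Finset.range t, (τ - ∑ d ∈ Finset.range (t - 1 - s), p (d + 1)) * writeLength ξ s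

lemma writeLength_nonneg (ξ : ℕ → EuclideanSpace ℝ (Fin n)) (s : ℕ) : 0 ≤ writeLength ξ s :=
  l1Norm_nonneg _

lemma meanStaleness_nonneg {p : ℕ → ℝ} (hp : ∀ d, 0 ≤ p d)
    (ξ : ℕ → EuclideanSpace ℝ (Fin n)) (t : ℕ) : 0 ≤ meanStaleness p ξ t :=
  Finset.sum_nonneg fun _ _ => mul_nonneg (hp _) (writeLength_nonneg _ _)

/-- The weight p (t - s) in the mean staleness is the next tail in the sum already deducted for
write s, so subtracting it lengthens that sum by one. -/
lemma pendingStaleness_sub (p : ℕ → ℝ) (τ : ℝ) (ξ : ℕ → EuclideanSpace ℝ (Fin n)) (t : ℕ) :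
    pendingStaleness p τ ξ t - meanStaleness p ξ t
      = ∑ s ∈ Finset.range t, (τ - ∑ d ∈ Finset.range (t - s), p (d + 1)) * writeLength ξ s := by
  rw [pendingStaleness, meanStaleness, ← Finset.sum_sub_distrib]
  refine Finset.sum_congr rfl fun s hs => ?_
  have hs' := Finset.mem_range.1 hs
  have h1 : t - s = t - 1 - s + 1 := by omega
  rw [h1, Finset.sum_range_succ]
  ring

/-- The balance sheet: the staleness due at step t is paid off, and the new write enters with its
full future cost τ. -/
lemma pendingStaleness_succ (p : ℕ → ℝ) (τ : ℝ) (ξ : ℕ → EuclideanSpace ℝ (Fin n)) (t : ℕ) :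
    pendingStaleness p τ ξ (t + 1)
      = pendingStaleness p τ ξ t - meanStaleness p ξ t + τ * writeLength ξ t := by
  rw [pendingStaleness_sub, pendingStaleness, Finset.sum_range_succ]
  simp

lemma meanStaleness_le_pendingStaleness {p : ℕ → ℝ} {τ : ℝ}
    (hp : ∀ k, ∑ d ∈ Finset.range k, p (d + 1) ≤ τ) (ξ : ℕ → EuclideanSpace ℝ (Fin n)) (t : ℕ) :
    meanStaleness p ξ t ≤ pendingStaleness p τ ξ t := by
  rw [← sub_nonneg, pendingStaleness_sub]
  exact Finset.sum_nonneg fun s _ => mul_nonneg (sub_nonneg.2 (hp _)) (writeLength_nonneg _ _)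

/-- Telescoping: write s is missing from a read with delay d only if d ≥ t - s. Delays beyond t are
covered by the truncated subtraction. -/
lemma abs_sub_le_sum_increments (f : ℕ → ℝ) (t d : ℕ) :
    |f (t - d) - f t| ≤ ∑ s ∈ Finset.range t, if t - s ≤ d then |f (s + 1) - f s| else 0 := by
  have h1 : f t - f (t - d) = ∑ s ∈ Finset.Ico (t - d) t, (f (s + 1) - f s) := by
    rw [Finset.sum_Ico_sub _ (Nat.sub_le t d)]
  rw [abs_sub_comm, h1, ← Finset.sum_filter]
  refine (Finset.abs_sum_le_sum_abs _ _).trans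
    (Finset.sum_le_sum_of_subset_of_nonneg (fun s hs => ?_) fun _ _ _ => abs_nonneg _)
  simp only [Finset.mem_Ico, Finset.mem_filter, Finset.mem_range] at hs ⊢
  omega

lemma l1Norm_staleRead_sub_le (ξ : ℕ → EuclideanSpace ℝ (Fin n)) (t : ℕ) (d : Fin n → ℕ) :
    l1Norm (staleRead ξ t d - ξ t)
      ≤ ∑ k, ∑ s ∈ Finset.range t, if t - s ≤ d k then |(ξ (s + 1) - ξ s) k| else 0 :=
  Finset.sum_le_sum fun k _ => abs_sub_le_sum_increments (fun s => ξ s k) t (d k)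

end Path

/-! ### Averaging over an independent sample and conditional tail bounds. -/

section Probability

variable {Ω : Type*} {m' mΩ : MeasurableSpace Ω} {P : Measure Ω} [IsProbabilityMeasure P]

/-- Averaging over a uniform sample that is independent of the rest. -/
lemma lintegral_sample {n : ℕ} {row col : Ω → Fin n} (hm' : m' ≤ mΩ)
    (hrow : Measurable row) (hcol : Measurable col)
    (hunif : ∀ a b, P.real {ω | row ω = a ∧ col ω = b} = 1 / (n : ℝ) ^ 2)
    (hind : Indep (MeasurableSpace.comap (fun ω => (row ω, col ω)) inferInstance) m' P)
    {f : Fin n → Fin n → Ω → ℝ} (hf : ∀ i j, Measurable[m'] (f i j)) (hf0 : ∀ i j ω, 0 ≤ f i j ω) :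
    ∫⁻ ω, ENNReal.ofReal (f (row ω) (col ω) ω) ∂P
      = ∫⁻ ω, ENNReal.ofReal (entryAvg fun i j => f i j ω) ∂P := by
  have hpair : Measurable fun ω => (row ω, col ω) := hrow.prodMk hcol
  have h1 : ∀ ω, ENNReal.ofReal (f (row ω) (col ω) ω) = ∑ p : Fin n × Fin n,
      (({p} : Set (Fin n × Fin n)).indicator 1 (row ω, col ω) : ENNReal) * ENNReal.ofReal (f p.1 p.2 ω) := by
    intro ω
    rw [Finset.sum_eq_single (row ω, col ω)]
    · simp
    · intro p _ hp
      rw [Set.indicator_of_notMem, zero_mul]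
      exact fun h => hp h.symm
    · simp
  have hone : ∀ p : Fin n × Fin n,
      Measurable fun q => (({p} : Set (Fin n × Fin n)).indicator 1 q : ENNReal) :=
    fun p => measurable_one.indicator (measurableSet_singleton p)
  have hof : ∀ p : Fin n × Fin n, Measurable[m'] fun ω => ENNReal.ofReal (f p.1 p.2 ω) :=
    fun p => ENNReal.measurable_ofReal.comp (hf p.1 p.2)
  have h2 : ∀ ω, ENNReal.ofReal (entryAvg fun i j => f i j ω) = ∑ p : Fin n × Fin n,
      ENNReal.ofReal (1 / (n : ℝ) ^ 2) * ENNReal.ofReal (f p.1 p.2 ω) := by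
    intro ω
    rw [entryAvg, div_eq_inv_mul, ← one_div, ENNReal.ofReal_mul (by positivity),
      ← Fintype.sum_prod_type (fun p : Fin n × Fin n => f p.1 p.2 ω),
      ENNReal.ofReal_sum_of_nonneg fun p _ => hf0 _ _ _, Finset.mul_sum]
  simp_rw [h1, h2]
  rw [lintegral_finsetSum, lintegral_finsetSum]
  · refine Finset.sum_congr rfl fun p _ => ?_
    rw [lintegral_mul_eq_lintegral_mul_lintegral_of_independent_measurableSpace
      (f := fun ω => ({p} : Set (Fin n × Fin n)).indicator 1 (row ω, col ω)) hpair.comap_le hm'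
      hind ((hone p).comp (comap_measurable _)) (hof p),
      lintegral_const_mul _ ((hof p).mono hm' le_rfl), ← hunif p.1 p.2, ofReal_measureReal]
    have hms : MeasurableSet {ω | row ω = p.1 ∧ col ω = p.2} :=
      (hrow (measurableSet_singleton p.1)).inter (hcol (measurableSet_singleton p.2))
    rw [← lintegral_indicator_one hms]
    congr 2
    ext ω
    by_cases h : (row ω, col ω) ∈ ({p} : Set (Fin n × Fin n))
    · have h' : (row ω, col ω) = p := h
      simp [← h']
    · rw [Set.indicator_of_notMem h, Set.indicator_of_notMem]
      exact fun h' => h (Prod.ext h'.1 h'.2)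
  · exact fun p _ => ((hof p).mono hm' le_rfl).const_mul _
  · exact fun p _ => ((hone p).comp hpair).mul ((hof p).mono hm' le_rfl)

/-- A bound of the conditional probability of `s` in terms of integrals. -/
lemma lintegral_indicator_le_of_condExp_le (hm' : m' ≤ mΩ) {s : Set Ω}
    (hs : MeasurableSet s) {p : ℝ} (hp : P⟦s | m'⟧ ≤ᵐ[P] fun _ => p)
    {Z : Ω → ENNReal} (hZ : Measurable[m'] Z) :
    ∫⁻ ω in s, Z ω ∂P ≤ ENNReal.ofReal p * ∫⁻ ω, Z ω ∂P := by
  -- The conditional bound is read as domination of measures on the small σ-algebra, so it applies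
  -- to every nonnegative measurable `Z` without integrability.
  have h1 : (P.restrict s).trim hm' ≤ ENNReal.ofReal p • P.trim hm' := by
    refine Measure.le_iff.2 fun G hG => ?_
    rw [trim_measurableSet_eq hm' hG, Measure.smul_apply, trim_measurableSet_eq hm' hG,
      Measure.restrict_apply (hm' G hG), smul_eq_mul]
    have e1 : ∫ ω in G, (P⟦s | m'⟧) ω ∂P = P.real (G ∩ s) := by
      rw [setIntegral_condExp hm' ((integrable_const (1 : ℝ)).indicator hs) hG,
        setIntegral_indicator hs]
      simp [measureReal_restrict_apply]
    have e2 : ∫ ω in G, (P⟦s | m'⟧) ω ∂P ≤ p * P.real G := by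
      refine (setIntegral_mono_ae integrable_condExp.integrableOn
        (integrable_const p).integrableOn hp).trans (le_of_eq ?_)
      simp [mul_comm]
    rw [e1] at e2
    rw [← ofReal_measureReal (μ := P) (s := G), ← ENNReal.ofReal_mul' measureReal_nonneg,
      ← ofReal_measureReal (μ := P) (s := G ∩ s)]
    exact ENNReal.ofReal_le_ofReal e2
  rw [← lintegral_trim hm' hZ, ← lintegral_trim hm' hZ, ← smul_eq_mul, ← lintegral_smul_measure]
  exact lintegral_mono' h1 le_rfl

end Probability

/-! ### Tail sums and measurability. -/

/-- The partial sums of the tail probabilities of a random natural number are at most its mean. -/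
lemma sum_tail_le_integral {Ω : Type*} {mΩ : MeasurableSpace Ω} {P : Measure Ω}
    [IsProbabilityMeasure P] {N : Ω → ℕ} (hN : Measurable N)
    (hint : Integrable (fun ω => (N ω : ℝ)) P) (k : ℕ) :
    ∑ d ∈ Finset.range k, P.real {ω | d + 1 ≤ N ω} ≤ ∫ ω, (N ω : ℝ) ∂P := by
  have hms : ∀ d : ℕ, MeasurableSet {ω | d + 1 ≤ N ω} :=
    fun d => measurableSet_le measurable_const hN
  have h1 : ∀ d : ℕ, P.real {ω | d + 1 ≤ N ω}
      = ∫ ω, {ω | d + 1 ≤ N ω}.indicator (fun _ => (1 : ℝ)) ω ∂P := by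
    intro d
    rw [integral_indicator (hms d)]
    simp
  simp_rw [h1]
  rw [← integral_finsetSum _ fun d _ => (integrable_const 1).indicator (hms d)]
  refine integral_mono (integrable_finsetSum _ fun d _ => (integrable_const 1).indicator (hms d))
    hint fun ω => ?_
  simp only [Set.indicator_apply, Set.mem_ofPred_eq]
  rw [Finset.sum_boole]
  have : (Finset.range k).filter (fun d => d + 1 ≤ N ω) ⊆ Finset.range (N ω) := by
    intro d hd
    simp only [Finset.mem_filter, Finset.mem_range] at hd ⊢
    omega
  exact_mod_cast (Finset.card_le_card this).trans (Finset.card_range _).le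

@[fun_prop]
lemma continuous_stretch {V : Type*} [NormedAddCommGroup V] [InnerProductSpace ℝ V] (u : V)
    (c : ℝ) : Continuous (stretch u c) := by
  unfold stretch; fun_prop

@[fun_prop]
lemma measurable_defect {n : ℕ} (u : EuclideanSpace ℝ (Fin n)) (c : ℝ) :
    Measurable (defect u c) := by
  unfold defect
  exact measurable_const.sub (((by fun_prop : Continuous fun x => inner ℝ u x ^ 2).measurable).div
    ((by fun_prop : Continuous fun x => ‖stretch u c x‖ ^ 2).measurable))

@[fun_prop]
lemma continuous_l1Norm {n : ℕ} : Continuous (l1Norm : EuclideanSpace ℝ (Fin n) → ℝ) := by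
  unfold l1Norm; fun_prop

lemma measurableSet_successSet {n : ℕ} (u : EuclideanSpace ℝ (Fin n)) (ε : ℝ) :
    MeasurableSet (successSet u ε) :=
  (isClosed_le (by fun_prop) (by fun_prop)).measurableSet

@[fun_prop]
lemma continuous_increment {n : ℕ} (A : Matrix (Fin n) (Fin n) ℝ) (η : ℝ) (i j : Fin n) :
    Continuous (increment A η i j) := by
  have : increment A η i j
      = fun v => (η * (n : ℝ) ^ 2 * A i j * v j) • EuclideanSpace.single i (1 : ℝ) :=
    funext fun v => increment_eq A η i j v
  rw [this]; fun_prop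

@[fun_prop]
lemma continuous_entryStep {n : ℕ} (A : Matrix (Fin n) (Fin n) ℝ) (η : ℝ) (i j : Fin n) :
    Continuous fun v => entryStep A η v i j := by
  unfold entryStep; fun_prop

lemma l1Norm_increment {n : ℕ} (A : Matrix (Fin n) (Fin n) ℝ) (η : ℝ) (i j : Fin n)
    (v : EuclideanSpace ℝ (Fin n)) : l1Norm (increment A η i j v) = |entryStep A η v i j| := by
  rw [l1Norm, Finset.sum_eq_single i]
  · simp [increment, entryStep]
  · intro k _ hk
    simp [increment, hk]
  · simp

/-- A stale read is measurable with respect to the past and the delays. -/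
lemma measurable_staleRead {n : ℕ} {Ω : Type*} {m : MeasurableSpace Ω}
    {x : ℕ → Ω → EuclideanSpace ℝ (Fin n)} {t : ℕ} {d : Fin n → Ω → ℕ}
    (hx : ∀ s ≤ t, Measurable (x s)) (hd : ∀ k, Measurable (d k)) :
    Measurable fun ω => staleRead (fun s => x s ω) t (fun k => d k ω) := by
  refine (PiLp.continuous_toLp 2 _).measurable.comp (measurable_pi_lambda _ fun k => ?_)
  -- Splitting by the value of the random index turns the read into a finite sum of measurable
  -- pieces.
  have h : (fun ω => x (t - d k ω) ω k) = fun ω => ∑ s ∈ Finset.range (t + 1),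
      if d k ω ∈ {e | t - e = s} then x s ω k else 0 := by
    ext ω
    rw [Finset.sum_eq_single (t - d k ω)]
    · simp
    · intro s _ hs
      exact if_neg fun h => hs h.symm
    · intro h
      exact absurd (Finset.mem_range.2 (by omega)) h
  rw [h]
  refine Finset.measurable_sum _ fun s hs => Measurable.ite (hd k (MeasurableSet.of_discrete)) ?_
    measurable_const
  exact (by fun_prop : Continuous fun v : EuclideanSpace ℝ (Fin n) => v k).measurable.comp
    (hx s (by have := Finset.mem_range.1 hs; omega))

/-! ### One step of the run in the mean. -/

namespace IsHogwildRun

variable {n : ℕ} {Ω Ω' : Type*} {mΩ : MeasurableSpace Ω} {mΩ' : MeasurableSpace Ω'}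
  {P : Measure Ω} {P' : Measure Ω'} {ℱ : Filtration ℕ mΩ}
  {A : Matrix (Fin n) (Fin n) ℝ} {η r : ℝ}
  {x : ℕ → Ω → EuclideanSpace ℝ (Fin n)} {row col : ℕ → Ω → Fin n}
  {delay : ℕ → Fin n → Ω → ℕ} {tauMax : Ω' → ℕ}

/-- All earlier iterates are carried through the induction because a stale read may use any of them.
-/
lemma measurable_iterate (hrun : IsHogwildRun P P' ℱ A η r x row col delay tauMax) (t : ℕ) :
    ∀ s ≤ t, Measurable[ℱ t] (x s) := by
  induction t with
  | zero =>
    intro s hs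
    rw [Nat.le_zero.1 hs]
    exact hrun.measurable_init
  | succ t ih =>
    intro s hs
    have ih' : ∀ s ≤ t, Measurable[ℱ (t + 1)] (x s) :=
      fun s hs => (ih s hs).mono (ℱ.mono (Nat.le_succ t)) le_rfl
    rcases Nat.le_succ_iff.1 hs with hs | rfl
    · exact ih' s hs
    · have hv := measurable_staleRead (m := ℱ (t + 1)) ih' (hrun.measurable_delay t)
      have h1 : x (t + 1) = fun ω => x t ω + ∑ i, ∑ j,
          if row t ω = i then if col t ω = j then increment A η i j
            (staleRead (fun s => x s ω) t (fun k => delay t k ω)) else 0 else 0 := by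
        ext1 ω
        rw [hrun.update t ω]
        simp
      rw [h1]
      refine (ih' t le_rfl).add (Finset.measurable_sum _ fun i _ => Finset.measurable_sum _
        fun j _ => ?_)
      refine Measurable.ite (hrun.measurable_row t (measurableSet_singleton i)) ?_
        measurable_const
      refine Measurable.ite (hrun.measurable_col t (measurableSet_singleton j)) ?_
        measurable_const
      exact (continuous_increment A η i j).measurable.comp hv

lemma measurable_writeLength (hrun : IsHogwildRun P P' ℱ A η r x row col delay tauMax)
    {s t : ℕ} (hst : s < t) : Measurable[ℱ t] fun ω => writeLength (fun s => x s ω) s :=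
  continuous_l1Norm.measurable.comp
    ((hrun.measurable_iterate t (s + 1) hst).sub (hrun.measurable_iterate t s hst.le))

lemma measurable_meanStaleness (hrun : IsHogwildRun P P' ℱ A η r x row col delay tauMax)
    (p : ℕ → ℝ) (t : ℕ) : Measurable[ℱ t] fun ω => meanStaleness p (fun s => x s ω) t :=
  Finset.measurable_sum _ fun _ hs =>
    (hrun.measurable_writeLength (Finset.mem_range.1 hs)).const_mul _

lemma measurable_pendingStaleness (hrun : IsHogwildRun P P' ℱ A η r x row col delay tauMax)
    (p : ℕ → ℝ) (τ : ℝ) (t : ℕ) :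
    Measurable[ℱ t] fun ω => pendingStaleness p τ (fun s => x s ω) t :=
  Finset.measurable_sum _ fun _ hs =>
    (hrun.measurable_writeLength (Finset.mem_range.1 hs)).const_mul _

/-- In the mean, the staleness of a read is at most `meanStaleness`. -/
lemma lintegral_staleness_le [IsProbabilityMeasure P]
    (hrun : IsHogwildRun P P' ℱ A η r x row col delay tauMax) (t : ℕ)
    {Z : Ω → ENNReal} (hZ : Measurable[ℱ t] Z) :
    ∫⁻ ω, Z ω * ENNReal.ofReal (l1Norm
        (staleRead (fun s => x s ω) t (fun k => delay t k ω) - x t ω)) ∂P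
      ≤ ∫⁻ ω, Z ω * ENNReal.ofReal (meanStaleness (fun d => P'.real {ω' | d ≤ tauMax ω'})
        (fun s => x s ω) t) ∂P := by
  set f : Fin n → ℕ → Ω → ENNReal :=
    fun k s ω => Z ω * ENNReal.ofReal |(x (s + 1) ω - x s ω) k| with hf
  have hfm : ∀ k, ∀ s ∈ Finset.range t, Measurable[ℱ t] (f k s) := by
    intro k s hs
    have hs := Finset.mem_range.1 hs
    refine hZ.mul (ENNReal.measurable_ofReal.comp ?_)
    exact (by fun_prop : Continuous fun v : EuclideanSpace ℝ (Fin n) => |v k|).measurable.comp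
      ((hrun.measurable_iterate t (s + 1) hs).sub (hrun.measurable_iterate t s hs.le))
  have hset : ∀ k d, MeasurableSet {ω | d ≤ delay t k ω} := fun k d =>
    ℱ.le (t + 1) _ (hrun.measurable_delay t k (MeasurableSet.of_discrete (s := {e | d ≤ e})))
  calc _ ≤ ∫⁻ ω, ∑ k, ∑ s ∈ Finset.range t,
        {ω | t - s ≤ delay t k ω}.indicator (f k s) ω ∂P := by
        refine lintegral_mono fun ω => ?_
        refine (mul_le_mul_right (ENNReal.ofReal_le_ofReal
          (l1Norm_staleRead_sub_le (fun s => x s ω) t (fun k => delay t k ω))) _).trans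
          (le_of_eq ?_)
        rw [ENNReal.ofReal_sum_of_nonneg, Finset.mul_sum]
        · refine Finset.sum_congr rfl fun k _ => ?_
          rw [ENNReal.ofReal_sum_of_nonneg, Finset.mul_sum]
          · refine Finset.sum_congr rfl fun s _ => ?_
            by_cases h : t - s ≤ delay t k ω
            · rw [if_pos h, Set.indicator_of_mem (by exact h)]
            · rw [if_neg h, Set.indicator_of_notMem (by exact h)]
              simp
          · intro s _
            split_ifs <;> positivity
        · intro k _
          refine Finset.sum_nonneg fun s _ => ?_
          split_ifs <;> positivity
    _ = ∑ k, ∑ s ∈ Finset.range t, ∫⁻ ω in {ω | t - s ≤ delay t k ω}, f k s ω ∂P := by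
        rw [lintegral_finsetSum]
        · refine Finset.sum_congr rfl fun k _ => ?_
          rw [lintegral_finsetSum]
          · exact Finset.sum_congr rfl fun s _ => lintegral_indicator (hset k _) _
          · exact fun s hs => ((hfm k s hs).mono (ℱ.le t) le_rfl).indicator (hset k _)
        · exact fun k _ => Finset.measurable_sum _ fun s hs =>
            ((hfm k s hs).mono (ℱ.le t) le_rfl).indicator (hset k _)
    -- Each past write is known before step t, so the conditional delay tail applies to it
    -- separately; the delays of different coordinates need not be independent.
    _ ≤ ∑ k, ∑ s ∈ Finset.range t,
        ENNReal.ofReal (P'.real {ω' | t - s ≤ tauMax ω'}) * ∫⁻ ω, f k s ω ∂P :=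
        Finset.sum_le_sum fun k _ => Finset.sum_le_sum fun s hs =>
          lintegral_indicator_le_of_condExp_le (ℱ.le t) (hset k _) (hrun.delay_tail t k _)
            (hfm k s hs)
    _ = ∫⁻ ω, ∑ k, ∑ s ∈ Finset.range t,
        ENNReal.ofReal (P'.real {ω' | t - s ≤ tauMax ω'}) * f k s ω ∂P := by
        rw [lintegral_finsetSum]
        · refine Finset.sum_congr rfl fun k _ => ?_
          rw [lintegral_finsetSum]
          · exact Finset.sum_congr rfl fun s hs =>
              (lintegral_const_mul _ ((hfm k s hs).mono (ℱ.le t) le_rfl)).symm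
          · exact fun s hs => ((hfm k s hs).mono (ℱ.le t) le_rfl).const_mul _
        · exact fun k _ => Finset.measurable_sum _ fun s hs =>
            ((hfm k s hs).mono (ℱ.le t) le_rfl).const_mul _
    _ = _ := by
        refine lintegral_congr fun ω => ?_
        rw [Finset.sum_comm, meanStaleness, ENNReal.ofReal_sum_of_nonneg, Finset.mul_sum]
        · refine Finset.sum_congr rfl fun s _ => ?_
          rw [writeLength, l1Norm, ENNReal.ofReal_mul measureReal_nonneg,
            ENNReal.ofReal_sum_of_nonneg fun _ _ => abs_nonneg _, Finset.mul_sum,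
            Finset.mul_sum]
          exact Finset.sum_congr rfl fun k _ => by rw [hf, mul_left_comm]
        · exact fun s _ => mul_nonneg measureReal_nonneg (writeLength_nonneg _ _)

/-- One step of the run: a bound for the average over the sampled entry yields a bound for the
mean. -/
lemma setLIntegral_step_le [IsProbabilityMeasure P]
    (hrun : IsHogwildRun P P' ℱ A η r x row col delay tauMax) {t : ℕ} {G : Set Ω}
    (hG : MeasurableSet[ℱ t] G) {f : Fin n → Fin n → Ω → ℝ} {U V : Ω → ℝ}
    (hf : ∀ i j, Measurable[(ℱ t : MeasurableSpace Ω) ⊔ MeasurableSpace.comap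
      (fun ω k => delay t k ω) inferInstance] (f i j)) (hf0 : ∀ i j ω, 0 ≤ f i j ω)
    (hU : Measurable[ℱ t] U) (hV : Measurable[ℱ t] V) (hU0 : ∀ ω ∈ G, 0 ≤ U ω)
    (hV0 : ∀ ω ∈ G, 0 ≤ V ω)
    (h : ∀ ω ∈ G, entryAvg (fun i j => f i j ω) ≤ U ω + V ω * l1Norm
        (staleRead (fun s => x s ω) t (fun k => delay t k ω) - x t ω)) :
    ∫⁻ ω in G, ENNReal.ofReal (f (row t ω) (col t ω) ω) ∂P
      ≤ ∫⁻ ω in G, ENNReal.ofReal (U ω + V ω * meanStaleness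
        (fun d => P'.real {ω' | d ≤ tauMax ω'}) (fun s => x s ω) t) ∂P := by
  have hd : Measurable (fun ω k => delay t k ω) :=
    measurable_pi_lambda _ fun k => (hrun.measurable_delay t k).mono (ℱ.le _) le_rfl
  have hm' : (ℱ t : MeasurableSpace Ω) ⊔ MeasurableSpace.comap
      (fun ω k => delay t k ω) inferInstance ≤ mΩ := sup_le (ℱ.le t) hd.comap_le
  have hGm := ℱ.le t G hG
  have hG' := (le_sup_left : (ℱ t : MeasurableSpace Ω) ≤ (ℱ t : MeasurableSpace Ω) ⊔
    MeasurableSpace.comap (fun ω k => delay t k ω) inferInstance) G hG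
  have h1 := lintegral_sample (f := fun i j => G.indicator (f i j)) hm'
    ((hrun.measurable_row t).mono (ℱ.le _) le_rfl) ((hrun.measurable_col t).mono (ℱ.le _) le_rfl)
    (hrun.sample_uniform t) (hrun.sample_indep t) (fun i j => (hf i j).indicator hG')
    (fun i j ω => Set.indicator_nonneg (fun ω _ => hf0 i j ω) ω)
  have hW0 := l1Norm_nonneg (n := n)
  have hD0 : ∀ ω, 0 ≤ meanStaleness (fun d => P'.real {ω' | d ≤ tauMax ω'})
    (fun s => x s ω) t := fun ω => meanStaleness_nonneg (fun _ => measureReal_nonneg) _ _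
  calc _ = ∫⁻ ω, ENNReal.ofReal (G.indicator (f (row t ω) (col t ω)) ω) ∂P := by
        rw [← lintegral_indicator hGm]
        refine lintegral_congr fun ω => ?_
        by_cases hω : ω ∈ G <;> simp [hω]
    -- The sample is averaged out first, with the past and the delays fixed; the delays are averaged
    -- only afterwards, by `lintegral_staleness_le`.
    _ = _ := h1
    _ ≤ ∫⁻ ω, (G.indicator (fun ω => ENNReal.ofReal (U ω)) ω
        + G.indicator (fun ω => ENNReal.ofReal (V ω)) ω * ENNReal.ofReal (l1Norm
        (staleRead (fun s => x s ω) t (fun k => delay t k ω) - x t ω))) ∂P := by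
        refine lintegral_mono fun ω => ?_
        by_cases hω : ω ∈ G
        · simp only [Set.indicator_of_mem hω]
          rw [← ENNReal.ofReal_mul (hV0 ω hω),
            ← ENNReal.ofReal_add (hU0 ω hω) (mul_nonneg (hV0 ω hω) (hW0 _))]
          exact ENNReal.ofReal_le_ofReal (h ω hω)
        · simp [Set.indicator_of_notMem hω, entryAvg]
    _ ≤ ∫⁻ ω, G.indicator (fun ω => ENNReal.ofReal (U ω)) ω ∂P
        + ∫⁻ ω, G.indicator (fun ω => ENNReal.ofReal (V ω)) ω * ENNReal.ofReal (meanStaleness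
        (fun d => P'.real {ω' | d ≤ tauMax ω'}) (fun s => x s ω) t) ∂P := by
        rw [lintegral_add_left]
        · exact add_le_add_right (hrun.lintegral_staleness_le t
            ((ENNReal.measurable_ofReal.comp hV).indicator hG)) _
        · exact ((ENNReal.measurable_ofReal.comp hU).mono (ℱ.le t) le_rfl).indicator hGm
    _ = _ := by
        rw [← lintegral_add_left, ← lintegral_indicator hGm]
        · refine lintegral_congr fun ω => ?_
          by_cases hω : ω ∈ G
          · simp only [Set.indicator_of_mem hω]
            rw [← ENNReal.ofReal_mul (hV0 ω hω),
              ← ENNReal.ofReal_add (hU0 ω hω) (mul_nonneg (hV0 ω hω) (hD0 _))]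
          · simp [Set.indicator_of_notMem hω]
        · exact ((ENNReal.measurable_ofReal.comp hU).mono (ℱ.le t) le_rfl).indicator hGm

end IsHogwildRun

/-! ### The two potentials. -/

section Potential

variable {n : ℕ} {Ω Ω' : Type*} {mΩ : MeasurableSpace Ω} {mΩ' : MeasurableSpace Ω'}
  {P : Measure Ω} {P' : Measure Ω'} {ℱ : Filtration ℕ mΩ}
  {A : Matrix (Fin n) (Fin n) ℝ}
  {u : OrthonormalBasis (Fin n) ℝ (EuclideanSpace ℝ (Fin n))} {lam : Fin n → ℝ} {i₀ : Fin n}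
  {Δ m ε γ η C τ X r : ℝ}
  {x : ℕ → Ω → EuclideanSpace ℝ (Fin n)} {row col : ℕ → Ω → Fin n}
  {delay : ℕ → Fin n → Ω → ℕ} {tauMax : Ω' → ℕ}

/-- A state outside the success set, with a defect of at most `1 / 2`, for which the bounds on the
iterates hold. -/
def IsActive (u : EuclideanSpace ℝ (Fin n)) (ε γ C : ℝ) (y : EuclideanSpace ℝ (Fin n)) : Prop :=
  y ∉ successSet u ε ∧ defect u (√(γ / n)) y ≤ 1 / 2 ∧ 1 ≤ ‖y‖ ∧ l1Norm y ≤ C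

lemma measurableSet_isActive (u : EuclideanSpace ℝ (Fin n)) (ε γ C : ℝ) :
    MeasurableSet {y | IsActive u ε γ C y} :=
  (measurableSet_successSet u ε).compl.inter
    ((measurableSet_le (measurable_defect u _) measurable_const).inter
      ((measurableSet_le measurable_const measurable_norm).inter
        (measurableSet_le continuous_l1Norm.measurable measurable_const)))

/-- The event that all iterates before step `t` are active. -/
def activeBefore (x : ℕ → Ω → EuclideanSpace ℝ (Fin n)) (u : EuclideanSpace ℝ (Fin n))
    (ε γ C : ℝ) (t : ℕ) : Set Ω :=
  {ω | ∀ s < t, IsActive u ε γ C (x s ω)}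

/-- The index t + 1 involves only the iterates up to x_t, all determined before write t. -/
lemma IsHogwildRun.measurableSet_activeBefore
    (hrun : IsHogwildRun P P' ℱ A η r x row col delay tauMax) (u : EuclideanSpace ℝ (Fin n))
    (ε γ C : ℝ) (t : ℕ) : MeasurableSet[ℱ t] (activeBefore x u ε γ C (t + 1)) := by
  have : activeBefore x u ε γ C (t + 1)
      = ⋂ s ∈ Finset.range (t + 1), x s ⁻¹' {y | IsActive u ε γ C y} := by
    ext ω; simp [activeBefore]
  rw [this]
  exact Finset.measurableSet_biInter _ fun s hs =>
    hrun.measurable_iterate t s (Nat.lt_succ_iff.1 (Finset.mem_range.1 hs))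
      (measurableSet_isActive u ε γ C)

/-- The square root of the defect at step `t`, weighted exponentially in the staleness that the
past writes may still cause. -/
noncomputable def weightedDefect (v : EuclideanSpace ℝ (Fin n)) (c κ τ : ℝ) (p : ℕ → ℝ)
    (ξ : ℕ → EuclideanSpace ℝ (Fin n)) (t : ℕ) : ℝ :=
  √(defect v c (ξ t)) * Real.exp (κ * pendingStaleness p τ ξ t)

lemma weightedDefect_nonneg (v : EuclideanSpace ℝ (Fin n)) (c κ τ : ℝ) (p : ℕ → ℝ)
    (ξ : ℕ → EuclideanSpace ℝ (Fin n)) (t : ℕ) : 0 ≤ weightedDefect v c κ τ p ξ t :=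
  mul_nonneg (Real.sqrt_nonneg _) (Real.exp_pos _).le

lemma weightedDefect_zero_le (v : EuclideanSpace ℝ (Fin n)) (c κ τ : ℝ) (p : ℕ → ℝ)
    (ξ : ℕ → EuclideanSpace ℝ (Fin n)) : weightedDefect v c κ τ p ξ 0 ≤ 1 := by
  simpa [weightedDefect, pendingStaleness] using defect_le_one v c (ξ 0)

lemma Regime.decay_le_one (h : Regime A u lam i₀ Δ m ε γ η C τ X) :
    η * Δ / 4 * (1 - X) ≤ 1 := by
  have h1 := h.progress_le
  have hηΔ : 0 < η * Δ := mul_pos h.η_pos h.gap_pos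
  have hn : (2 : ℝ) ≤ n := by exact_mod_cast h.two_le
  have h2 : 1 ≤ n * m ^ 4 :=
    one_le_mul_of_one_le_of_one_le (by linarith) (one_le_pow₀ h.one_le_m)
  have h3 : η * Δ ≤ ε * γ := by
    refine le_trans ?_ h1
    rw [mul_assoc (η * Δ)]
    exact le_mul_of_one_le_right hηΔ.le h2
  have h4 : ε * γ ≤ 1 := mul_le_one₀ h.ε_lt.le h.γ_pos.le (by linarith [h.γ_le])
  have := h.X_nonneg
  have := h.X_le
  nlinarith

lemma Regime.staleWeight_nonneg (h : Regime A u lam i₀ Δ m ε γ η C τ X) :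
    0 ≤ weightRate A m ε γ η - 2 * staleRate A m ε γ η / √γ := by
  refine le_trans ?_ h.stale_le_weight
  have := h.one_le_m
  have := h.η_pos
  have := h.frobenius_pos
  have := h.weightRate_nonneg
  have := h.τ_nonneg
  positivity

variable [IsProbabilityMeasure P]

/-- The evolution of a combination of the defect and the weighted defect in one step. -/
lemma Regime.lintegral_potential_succ_le (h : Regime A u lam i₀ Δ m ε γ η C τ X)
    (hrun : IsHogwildRun P P' ℱ A η r x row col delay tauMax) {a b : ℝ} (ha : 0 ≤ a) (hb : 0 ≤ b)
    {p : ℕ → ℝ} (hp : p = fun d => P'.real {ω' | d ≤ tauMax ω'}) (t : ℕ) :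
    ∫⁻ ω in activeBefore x (u i₀) ε γ C (t + 1),
        ENNReal.ofReal (a * defect (u i₀) (√(γ / n)) (x (t + 1) ω) + b * weightedDefect (u i₀)
          (√(γ / n)) (weightRate A m ε γ η) τ p (fun s => x s ω) (t + 1)) ∂P
      ≤ ∫⁻ ω in activeBefore x (u i₀) ε γ C (t + 1),
        ENNReal.ofReal (a * defect (u i₀) (√(γ / n)) (x t ω)
          + b * (Real.exp (weightRate A m ε γ η * (pendingStaleness p τ (fun s => x s ω) t
              - meanStaleness p (fun s => x s ω) t)) * (√(defect (u i₀) (√(γ / n)) (x t ω))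
              * (1 - η * Δ / 4 * (1 - X))))
          + (a * (2 * staleRate A m ε γ η * √(defect (u i₀) (√(γ / n)) (x t ω)))
            + b * (Real.exp (weightRate A m ε γ η * (pendingStaleness p τ (fun s => x s ω) t
              - meanStaleness p (fun s => x s ω) t)) * (√(defect (u i₀) (√(γ / n)) (x t ω))
              * (weightRate A m ε γ η - 2 * staleRate A m ε γ η / √γ))))
            * meanStaleness p (fun s => x s ω) t) ∂P := by
  have hu := u.norm_eq_one i₀
  set κ := weightRate A m ε γ η
  set K := staleRate A m ε γ η
  set c := √(γ / n)
  set E : Ω → ℝ := fun ω => Real.exp (κ * (pendingStaleness p τ (fun s => x s ω) t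
    - meanStaleness p (fun s => x s ω) t)) with hE
  set v : Ω → EuclideanSpace ℝ (Fin n) :=
    fun ω => staleRead (fun s => x s ω) t (fun k => delay t k ω) with hv
  set m' : MeasurableSpace Ω := (ℱ t : MeasurableSpace Ω) ⊔ MeasurableSpace.comap
      (fun ω k => delay t k ω) inferInstance with hm'
  have hle : (ℱ t : MeasurableSpace Ω) ≤ m' := le_sup_left
  have hxt : Measurable[ℱ t] (x t) := hrun.measurable_iterate t t le_rfl
  have hEm : Measurable[ℱ t] E := Real.measurable_exp.comp
    (((hrun.measurable_pendingStaleness p τ t).sub (hrun.measurable_meanStaleness p t)).const_mul κ)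
  have hdelay : ∀ k, Measurable[m'] (delay t k) := fun k =>
    ((measurable_pi_apply k).comp (comap_measurable (fun ω k => delay t k ω))).mono
      le_sup_right le_rfl
  have hvm : Measurable[m'] v :=
    measurable_staleRead (m := m') (fun s hs => (hrun.measurable_iterate t s hs).mono hle le_rfl)
      hdelay
  have hθm : Measurable[ℱ t] fun ω => defect (u i₀) c (x t ω) := (measurable_defect _ c).comp hxt
  have hφm : Measurable[ℱ t] fun ω => √(defect (u i₀) c (x t ω)) :=
    Real.continuous_sqrt.measurable.comp hθm
  have hstep : ∀ i j, Measurable[m'] fun ω => defect (u i₀) c (x t ω + increment A η i j (v ω)) :=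
    fun i j => (measurable_defect _ c).comp
      ((hxt.mono hle le_rfl).add ((continuous_increment A η i j).measurable.comp hvm))
  have hk0 := h.staleWeight_nonneg
  have hd1 := h.decay_le_one
  have hK0 := h.staleRate_nonneg
  have key := hrun.setLIntegral_step_le (t := t)
    (hrun.measurableSet_activeBefore (u i₀) ε γ C t)
    (f := fun i j ω => a * defect (u i₀) c (x t ω + increment A η i j (v ω))
      + b * (E ω * (√(defect (u i₀) c (x t ω + increment A η i j (v ω)))
        * Real.exp (κ * τ * |entryStep A η (v ω) i j|))))
    (U := fun ω => a * defect (u i₀) c (x t ω)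
          + b * (E ω * (√(defect (u i₀) c (x t ω)) * (1 - η * Δ / 4 * (1 - X)))))
    (V := fun ω => a * (2 * K * √(defect (u i₀) c (x t ω)))
            + b * (E ω * (√(defect (u i₀) c (x t ω)) * (κ - 2 * K / √γ))))
    (fun i j => ((hstep i j).const_mul a).add (((hEm.mono hle le_rfl).mul
      ((Real.continuous_sqrt.measurable.comp (hstep i j)).mul (Real.measurable_exp.comp
        (((by fun_prop : Continuous fun y => |entryStep A η y i j|).measurable.comp
          hvm).const_mul _)))).const_mul b))
    (fun i j ω => by
      have := defect_nonneg hu c (x t ω + increment A η i j (v ω))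
      positivity)
    ((hθm.const_mul a).add ((hEm.mul (hφm.mul_const _)).const_mul b))
    (((hφm.const_mul _).const_mul a).add ((hEm.mul (hφm.mul_const _)).const_mul b))
    (fun ω _ => by
      have := defect_nonneg hu c (x t ω)
      have : 0 ≤ 1 - η * Δ / 4 * (1 - X) := by linarith
      positivity)
    (fun ω _ => by positivity)
    (fun ω hω => by
      obtain ⟨hxS, hθ, hx1, hxC⟩ := hω t (Nat.lt_succ_self t)
      -- Each coordinate read comes from an iterate no later than t, which is active.
      have hvC : ∀ k, |(x t ω + (v ω - x t ω)) k| ≤ C := by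
        intro k
        rw [add_sub_cancel]
        have hs := (hω (t - delay t k ω) (by omega)).2.2.2
        exact (abs_apply_le_l1Norm (x (t - delay t k ω) ω) k).trans hs
      have e1 := h.entryAvg_defect_step_le (w := v ω - x t ω) hx1 hxS hθ
      have e2 := h.entryAvg_sqrt_defect_step_le (w := v ω - x t ω) hx1 hxC hvC hxS hθ
      rw [add_sub_cancel] at e1 e2
      rw [entryAvg_add, entryAvg_const_mul, entryAvg_const_mul, entryAvg_const_mul]
      have hE0 : 0 ≤ E ω := (Real.exp_pos _).le
      have e3 := mul_le_mul_of_nonneg_left e1 ha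
      have e4 := mul_le_mul_of_nonneg_left (mul_le_mul_of_nonneg_left e2 hE0) hb
      refine (add_le_add e3 e4).trans (le_of_eq ?_)
      ring)
  rw [← hp] at key
  refine le_trans (le_of_eq ?_) key
  refine lintegral_congr fun ω => ?_
  have hup := hrun.update t ω
  have hwl : writeLength (fun s => x s ω) t = |entryStep A η (v ω) (row t ω) (col t ω)| := by
    rw [writeLength, hup, add_sub_cancel_left, l1Norm_increment]
  rw [weightedDefect, pendingStaleness_succ, hwl, hup]
  -- The weight after the step splits into a factor known before it and one depending only on the
  -- current write.
  have hexp : Real.exp (κ * (pendingStaleness p τ (fun s => x s ω) t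
      - meanStaleness p (fun s => x s ω) t + τ * |entryStep A η (v ω) (row t ω) (col t ω)|))
      = E ω * Real.exp (κ * τ * |entryStep A η (v ω) (row t ω) (col t ω)|) := by
    rw [hE, ← Real.exp_add]; ring_nf
  rw [hexp]
  congr 1
  ring

/-- While the iterates are active, the mean of the combined potential does not increase. -/
lemma Regime.lintegral_defect_add_le (h : Regime A u lam i₀ Δ m ε γ η C τ X)
    (hrun : IsHogwildRun P P' ℱ A η r x row col delay tauMax)
    {p : ℕ → ℝ} (hp : p = fun d => P'.real {ω' | d ≤ tauMax ω'})
    (hpτ : ∀ k, ∑ d ∈ Finset.range k, p (d + 1) ≤ τ) (t : ℕ) :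
    ∫⁻ ω in activeBefore x (u i₀) ε γ C (t + 1),
        ENNReal.ofReal (defect (u i₀) (√(γ / n)) (x (t + 1) ω) + √γ * weightedDefect (u i₀)
          (√(γ / n)) (weightRate A m ε γ η) τ p (fun s => x s ω) (t + 1)) ∂P
      ≤ ∫⁻ ω in activeBefore x (u i₀) ε γ C (t + 1),
        ENNReal.ofReal (defect (u i₀) (√(γ / n)) (x t ω) + √γ * weightedDefect (u i₀)
          (√(γ / n)) (weightRate A m ε γ η) τ p (fun s => x s ω) t) ∂P := by
  have key := h.lintegral_potential_succ_le hrun zero_le_one (Real.sqrt_nonneg γ) hp t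
  simp only [one_mul] at key
  refine key.trans (lintegral_mono fun ω => ENNReal.ofReal_le_ofReal ?_)
  have hD0 : 0 ≤ meanStaleness p (fun s => x s ω) t :=
    meanStaleness_nonneg (by rw [hp]; exact fun _ => measureReal_nonneg) _ _
  have hDS := meanStaleness_le_pendingStaleness hpτ (fun s => x s ω) t
  have hκ := h.weightRate_nonneg
  have hK := h.staleRate_nonneg
  have hd0 : 0 ≤ η * Δ / 4 * (1 - X) :=
    mul_nonneg (by have := mul_pos h.η_pos h.gap_pos; linarith) (by linarith [h.X_le])
  have hsγ := Real.sqrt_pos.2 h.γ_pos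
  rw [weightedDefect]
  set κ := weightRate A m ε γ η
  set K := staleRate A m ε γ η
  set S := pendingStaleness p τ (fun s => x s ω) t
  set D := meanStaleness p (fun s => x s ω) t
  set φ := √(defect (u i₀) (√(γ / n)) (x t ω)) with hφdef
  have hφ : 0 ≤ φ := Real.sqrt_nonneg _
  have hES : Real.exp (κ * S) = Real.exp (κ * (S - D)) * Real.exp (κ * D) := by
    rw [← Real.exp_add]; ring_nf
  have hED : 1 + κ * D ≤ Real.exp (κ * D) := by
    rw [add_comm]; exact Real.add_one_le_exp _
  have hE1 : 1 ≤ Real.exp (κ * (S - D)) := Real.one_le_exp (mul_nonneg hκ (by linarith))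
  rw [hES]
  set E := Real.exp (κ * (S - D))
  -- The unweighted defect may grow by 2KφD. The reserve -2K/√γ in the weighted part, multiplied by
  -- √γ and by E ≥ 1, compensates for it.
  have h1 : √γ * (φ * (E * (1 + κ * D))) ≤ √γ * (φ * (E * Real.exp (κ * D))) := by gcongr
  have h2 : 2 * K * φ * D ≤ E * (2 * K * φ * D) := le_mul_of_one_le_left (by positivity) hE1
  have h3 : √γ * (E * (φ * (κ - 2 * K / √γ))) * D
      = √γ * (E * (φ * κ)) * D - E * (2 * K * φ * D) := by field_simp
  have h4 : 0 ≤ √γ * (E * (φ * (η * Δ / 4 * (1 - X)))) := by positivity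
  nlinarith

/-- While the iterates are active, the mean of the weighted defect decays geometrically. -/
lemma Regime.lintegral_weightedDefect_le (h : Regime A u lam i₀ Δ m ε γ η C τ X)
    (hrun : IsHogwildRun P P' ℱ A η r x row col delay tauMax)
    {p : ℕ → ℝ} (hp : p = fun d => P'.real {ω' | d ≤ tauMax ω'}) (t : ℕ) :
    ∫⁻ ω in activeBefore x (u i₀) ε γ C (t + 1), ENNReal.ofReal (weightedDefect (u i₀)
          (√(γ / n)) (weightRate A m ε γ η) τ p (fun s => x s ω) (t + 1)) ∂P
      ≤ ENNReal.ofReal (Real.exp (-(η * Δ / 4 * (1 - X)))) *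
        ∫⁻ ω in activeBefore x (u i₀) ε γ C (t + 1), ENNReal.ofReal (weightedDefect (u i₀)
          (√(γ / n)) (weightRate A m ε γ η) τ p (fun s => x s ω) t) ∂P := by
  have key := h.lintegral_potential_succ_le hrun le_rfl zero_le_one hp t
  simp only [one_mul, zero_mul, zero_add] at key
  rw [← lintegral_const_mul' _ _ ENNReal.ofReal_ne_top]
  refine key.trans (lintegral_mono fun ω => ?_)
  rw [← ENNReal.ofReal_mul (Real.exp_pos _).le]
  refine ENNReal.ofReal_le_ofReal ?_
  have hD0 : 0 ≤ meanStaleness p (fun s => x s ω) t :=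
    meanStaleness_nonneg (by rw [hp]; exact fun _ => measureReal_nonneg) _ _
  have hK := h.staleRate_nonneg
  have hsγ := Real.sqrt_pos.2 h.γ_pos
  rw [weightedDefect]
  set κ := weightRate A m ε γ η
  set K := staleRate A m ε γ η
  set S := pendingStaleness p τ (fun s => x s ω) t
  set D := meanStaleness p (fun s => x s ω) t
  set φ := √(defect (u i₀) (√(γ / n)) (x t ω)) with hφdef
  set d := η * Δ / 4 * (1 - X)
  have hφ : 0 ≤ φ := Real.sqrt_nonneg _
  -- The factor exp(κD) released when D leaves the pending account pays for the stale error at step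
  -- t.
  have h1 : 1 - d + (κ - 2 * K / √γ) * D ≤ Real.exp (-d + κ * D) := by
    have : 0 ≤ 2 * K / √γ * D := by positivity
    have := Real.add_one_le_exp (-d + κ * D)
    linarith
  have h2 : Real.exp (-d) * (φ * Real.exp (κ * S))
      = Real.exp (κ * (S - D)) * φ * Real.exp (-d + κ * D) := by
    rw [mul_left_comm, ← Real.exp_add, mul_right_comm, ← Real.exp_add, mul_comm]
    ring_nf
  rw [h2]
  calc _ = Real.exp (κ * (S - D)) * φ * (1 - d + (κ - 2 * K / √γ) * D) := by ring
    _ ≤ _ := mul_le_mul_of_nonneg_left h1 (by positivity)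

end Potential

/-! ### From potentials to the probability of failure. -/

section Failure

variable {n : ℕ} {Ω Ω' : Type*} {mΩ : MeasurableSpace Ω} {mΩ' : MeasurableSpace Ω'}
  {P : Measure Ω} {P' : Measure Ω'} {ℱ : Filtration ℕ mΩ}
  {A : Matrix (Fin n) (Fin n) ℝ}
  {u : OrthonormalBasis (Fin n) ℝ (EuclideanSpace ℝ (Fin n))} {lam : Fin n → ℝ} {i₀ : Fin n}
  {Δ m ε γ η C τ X r : ℝ}
  {x : ℕ → Ω → EuclideanSpace ℝ (Fin n)} {row col : ℕ → Ω → Fin n}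
  {delay : ℕ → Fin n → Ω → ℕ} {tauMax : Ω' → ℕ}

lemma activeBefore_succ (x : ℕ → Ω → EuclideanSpace ℝ (Fin n)) (v : EuclideanSpace ℝ (Fin n))
    (ε γ C : ℝ) (t : ℕ) :
    activeBefore x v ε γ C (t + 1) ⊆ activeBefore x v ε γ C t :=
  fun _ hω s hs => hω s (hs.trans (Nat.lt_succ_self t))

/-- The event that step `t` is the first at which the defect exceeds `1 / 2`. -/
def exitAt (x : ℕ → Ω → EuclideanSpace ℝ (Fin n)) (v : EuclideanSpace ℝ (Fin n))
    (ε γ C : ℝ) (t : ℕ) : Set Ω :=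
  activeBefore x v ε γ C t ∩ {ω | 1 / 2 < defect v (√(γ / n)) (x t ω)}

lemma IsHogwildRun.measurable_apply (hrun : IsHogwildRun P P' ℱ A η r x row col delay tauMax)
    (t : ℕ) : Measurable (x t) :=
  (hrun.measurable_iterate t t le_rfl).mono (ℱ.le t) le_rfl

lemma IsHogwildRun.measurableSet_defect_gt
    (hrun : IsHogwildRun P P' ℱ A η r x row col delay tauMax) (v : EuclideanSpace ℝ (Fin n))
    (γ : ℝ) (t : ℕ) : MeasurableSet {ω | 1 / 2 < defect v (√(γ / n)) (x t ω)} :=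
  measurableSet_lt measurable_const ((measurable_defect v _).comp (hrun.measurable_apply t))

variable [IsProbabilityMeasure P]

/-- The probability that the defect ever exceeds `1 / 2`. -/
lemma Regime.sum_measure_exitAt_le (h : Regime A u lam i₀ Δ m ε γ η C τ X)
    (hrun : IsHogwildRun P P' ℱ A η r x row col delay tauMax)
    {p : ℕ → ℝ} (hp : p = fun d => P'.real {ω' | d ≤ tauMax ω'})
    (hpτ : ∀ k, ∑ d ∈ Finset.range k, p (d + 1) ≤ τ) (t : ℕ) :
    ENNReal.ofReal (1 / 2) * ∑ s ∈ Finset.range t, P (exitAt x (u i₀) ε γ C s)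
      + ∫⁻ ω in activeBefore x (u i₀) ε γ C t,
        ENNReal.ofReal (defect (u i₀) (√(γ / n)) (x t ω) + √γ * weightedDefect (u i₀)
          (√(γ / n)) (weightRate A m ε γ η) τ p (fun s => x s ω) t) ∂P
      ≤ ∫⁻ ω, ENNReal.ofReal (defect (u i₀) (√(γ / n)) (x 0 ω) + √γ) ∂P := by
  induction t with
  | zero =>
    simp only [Finset.range_zero, Finset.sum_empty, mul_zero, zero_add]
    refine (setLIntegral_le_lintegral _ _).trans (lintegral_mono fun ω => ?_)
    refine ENNReal.ofReal_le_ofReal (add_le_add le_rfl ?_)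
    exact mul_le_of_le_one_right (Real.sqrt_nonneg _) (weightedDefect_zero_le _ _ _ _ _ _)
  | succ t ih =>
    refine le_trans ?_ ih
    rw [Finset.sum_range_succ, mul_add, add_assoc]
    refine add_le_add le_rfl ((add_le_add le_rfl
      (h.lintegral_defect_add_le hrun hp hpτ t)).trans ?_)
    set Y : Ω → ENNReal := fun ω => ENNReal.ofReal (defect (u i₀) (√(γ / n)) (x t ω)
      + √γ * weightedDefect (u i₀) (√(γ / n)) (weightRate A m ε γ η) τ p (fun s => x s ω) t)
    have hms := hrun.measurableSet_defect_gt (u i₀) γ t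
    -- Paths that exit at t and paths that continue are disjoint, so the potential on the former can
    -- be charged to the exit probability once and for all.
    have hsub : activeBefore x (u i₀) ε γ C (t + 1) ⊆ activeBefore x (u i₀) ε γ C t
        ∩ {ω | 1 / 2 < defect (u i₀) (√(γ / n)) (x t ω)}ᶜ := fun ω hω =>
      ⟨activeBefore_succ _ _ _ _ _ _ hω, not_lt.2 (hω t (Nat.lt_succ_self t)).2.1⟩
    have h1 : ENNReal.ofReal (1 / 2) * P (exitAt x (u i₀) ε γ C t)
        ≤ ∫⁻ ω in exitAt x (u i₀) ε γ C t, Y ω ∂P := by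
      rw [← setLIntegral_const]
      have hmeas : Measurable Y := ENNReal.measurable_ofReal.comp
        (((measurable_defect _ _).comp (hrun.measurable_apply t)).add
          (((Real.continuous_sqrt.measurable.comp
            ((measurable_defect _ _).comp (hrun.measurable_apply t))).mul
            (Real.measurable_exp.comp (((hrun.measurable_pendingStaleness p τ t).mono
              (ℱ.le t) le_rfl).const_mul _))).const_mul _))
      refine setLIntegral_mono hmeas fun ω hω => ENNReal.ofReal_le_ofReal ?_
      have h2 : 0 ≤ √γ * weightedDefect (u i₀) (√(γ / n)) (weightRate A m ε γ η) τ p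
          (fun s => x s ω) t := mul_nonneg (Real.sqrt_nonneg _) (weightedDefect_nonneg _ _ _ _ _ _ _)
      have h3 : 1 / 2 < defect (u i₀) (√(γ / n)) (x t ω) := hω.2
      linarith
    calc _ ≤ ∫⁻ ω in exitAt x (u i₀) ε γ C t, Y ω ∂P
        + ∫⁻ ω in activeBefore x (u i₀) ε γ C t
          ∩ {ω | 1 / 2 < defect (u i₀) (√(γ / n)) (x t ω)}ᶜ, Y ω ∂P :=
          add_le_add h1 (lintegral_mono_set hsub)
      _ = _ := by
        rw [← Set.sdiff_eq]
        exact lintegral_inter_add_sdiff _ _ hms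

/-- The probability that all iterates before step `t + 1` are active. -/
lemma Regime.measure_activeBefore_le (h : Regime A u lam i₀ Δ m ε γ η C τ X)
    (hrun : IsHogwildRun P P' ℱ A η r x row col delay tauMax)
    {p : ℕ → ℝ} (hp : p = fun d => P'.real {ω' | d ≤ tauMax ω'})
    (hpτ : ∀ k, ∑ d ∈ Finset.range k, p (d + 1) ≤ τ) (t : ℕ) :
    ENNReal.ofReal (√(γ * ε / n)) * P (activeBefore x (u i₀) ε γ C (t + 1))
      ≤ ENNReal.ofReal (Real.exp (-(t * (η * Δ / 4 * (1 - X))))) := by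
  have hp0 : ∀ d, 0 ≤ p d := by rw [hp]; exact fun _ => measureReal_nonneg
  set d := η * Δ / 4 * (1 - X)
  have h1 : ∀ t : ℕ, ∫⁻ ω in activeBefore x (u i₀) ε γ C t, ENNReal.ofReal (weightedDefect (u i₀)
      (√(γ / n)) (weightRate A m ε γ η) τ p (fun s => x s ω) t) ∂P
      ≤ ENNReal.ofReal (Real.exp (-(t * d))) := by
    intro t
    induction t with
    | zero =>
      refine (setLIntegral_le_lintegral _ _).trans ((lintegral_mono fun ω =>
        ENNReal.ofReal_le_ofReal (weightedDefect_zero_le _ _ _ _ _ _)).trans ?_)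
      simp
    | succ t ih =>
      refine (h.lintegral_weightedDefect_le hrun hp t).trans ?_
      refine (mul_le_mul_right ((lintegral_mono_set (activeBefore_succ _ _ _ _ _ _)).trans ih)
        _).trans (le_of_eq ?_)
      rw [← ENNReal.ofReal_mul (Real.exp_pos _).le, ← Real.exp_add]
      congr 2
      push_cast
      ring
  -- Decay is used for t steps only; activity at time t itself supplies the lower bound √(γε/n) on
  -- the weighted defect.
  refine le_trans ?_ (h1 t)
  refine le_trans ?_ (lintegral_mono_set (activeBefore_succ _ _ _ _ _ _))
  rw [← setLIntegral_const]
  have hmeas : Measurable fun ω => ENNReal.ofReal (weightedDefect (u i₀)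
      (√(γ / n)) (weightRate A m ε γ η) τ p (fun s => x s ω) t) :=
    ENNReal.measurable_ofReal.comp ((Real.continuous_sqrt.measurable.comp
      ((measurable_defect _ _).comp (hrun.measurable_apply t))).mul
      (Real.measurable_exp.comp (((hrun.measurable_pendingStaleness p τ t).mono
        (ℱ.le t) le_rfl).const_mul _)))
  refine setLIntegral_mono hmeas fun ω hω => ENNReal.ofReal_le_ofReal ?_
  obtain ⟨hxS, -, hx1, -⟩ := hω t (Nat.lt_succ_self t)
  obtain ⟨-, h2, -⟩ := h.state_bounds hx1 hxS rfl rfl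
  have h3 : 0 ≤ pendingStaleness p τ (fun s => x s ω) t :=
    (meanStaleness_nonneg hp0 _ _).trans (meanStaleness_le_pendingStaleness hpτ _ _)
  calc _ ≤ √(defect (u i₀) (√(γ / n)) (x t ω)) := Real.sqrt_le_sqrt h2
    _ ≤ _ := le_mul_of_one_le_right (Real.sqrt_nonneg _)
        (Real.one_le_exp (mul_nonneg h.weightRate_nonneg h3))

/-- The probability of failure up to step `N`. -/
lemma Regime.measure_failure_le (h : Regime A u lam i₀ Δ m ε γ η C τ X)
    (hrun : IsHogwildRun P P' ℱ A η r x row col delay tauMax)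
    (hpτ : ∀ k, ∑ d ∈ Finset.range k, P'.real {ω' | d + 1 ≤ tauMax ω'} ≤ τ) (N : ℕ)
    (hbdd : ∀ t ≤ N, ∀ᵐ ω ∂P, 1 ≤ ‖x t ω‖ ∧ l1Norm (x t ω) ≤ C) {e : ℝ} (he0 : 0 ≤ e)
    (he : ∫⁻ ω, ENNReal.ofReal (defect (u i₀) (√(γ / n)) (x 0 ω)) ∂P ≤ ENNReal.ofReal e) :
    P.real {ω | ∀ t ≤ N, x t ω ∉ successSet (u i₀) ε}
      ≤ 2 * (e + √γ) + Real.exp (-(N * (η * Δ / 4 * (1 - X)))) / √(γ * ε / n) := by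
  have hn : (2 : ℝ) ≤ n := by exact_mod_cast h.two_le
  have hθ0 : 0 < √(γ * ε / n) := by
    have := h.γ_pos
    have := h.ε_pos
    exact Real.sqrt_pos.2 (by positivity)
  have h1 := (le_self_add).trans (h.sum_measure_exitAt_le hrun rfl hpτ (N + 1))
  have h2 := h.measure_activeBefore_le hrun rfl hpτ N
  have h3 : ∑ s ∈ Finset.range (N + 1), P (exitAt x (u i₀) ε γ C s)
      ≤ ENNReal.ofReal (2 * (e + √γ)) := by
    have e1 : ∫⁻ ω, ENNReal.ofReal (defect (u i₀) (√(γ / n)) (x 0 ω) + √γ) ∂P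
        ≤ ENNReal.ofReal (e + √γ) := by
      rw [ENNReal.ofReal_add he0 (Real.sqrt_nonneg _)]
      calc _ = ∫⁻ ω, (ENNReal.ofReal (defect (u i₀) (√(γ / n)) (x 0 ω))
            + ENNReal.ofReal √γ) ∂P := lintegral_congr fun ω =>
            ENNReal.ofReal_add (defect_nonneg (u.norm_eq_one i₀) _ _) (Real.sqrt_nonneg _)
        _ = ∫⁻ ω, ENNReal.ofReal (defect (u i₀) (√(γ / n)) (x 0 ω)) ∂P + ENNReal.ofReal √γ := by
            rw [lintegral_add_right _ measurable_const]; simp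
        _ ≤ _ := add_le_add he le_rfl
    have e2 := mul_le_mul_right (h1.trans e1) (ENNReal.ofReal 2)
    rw [← mul_assoc, ← ENNReal.ofReal_mul (by norm_num), ← ENNReal.ofReal_mul (by norm_num)] at e2
    norm_num at e2
    simpa using e2
  have h4 : P (activeBefore x (u i₀) ε γ C (N + 1))
      ≤ ENNReal.ofReal (Real.exp (-(N * (η * Δ / 4 * (1 - X)))) / √(γ * ε / n)) := by
    rw [ENNReal.ofReal_div_of_pos hθ0, ENNReal.le_div_iff_mul_le
      (Or.inl (ENNReal.ofReal_pos.2 hθ0).ne') (Or.inl ENNReal.ofReal_ne_top), mul_comm]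
    exact h2
  have h5 : P {ω | ∀ t ≤ N, x t ω ∉ successSet (u i₀) ε}
      ≤ P ((⋃ s ∈ Finset.range (N + 1), exitAt x (u i₀) ε γ C s)
        ∪ activeBefore x (u i₀) ε γ C (N + 1)) := by
    refine measure_mono_ae ?_
    have hall : ∀ᵐ ω ∂P, ∀ t ∈ Finset.range (N + 1), 1 ≤ ‖x t ω‖ ∧ l1Norm (x t ω) ≤ C :=
      (Finset.eventually_all _).2 fun t ht =>
        hbdd t (Nat.lt_succ_iff.1 (Finset.mem_range.1 ht))
    filter_upwards [hall] with ω hω hfail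
    -- A failing path either has a first time with defect above 1/2, or is active throughout.
    by_cases hex : ∃ s, s < N + 1 ∧ 1 / 2 < defect (u i₀) (√(γ / n)) (x s ω)
    · left
      classical
      obtain ⟨hs1, hs2⟩ := Nat.find_spec hex
      refine Set.mem_biUnion (Finset.mem_coe.2 (Finset.mem_range.2 hs1)) ⟨fun s hs => ?_, hs2⟩
      have hmin := Nat.find_min hex hs
      have hsN : s < N + 1 := hs.trans hs1
      exact ⟨hfail s (Nat.lt_succ_iff.1 hsN), not_lt.1 fun h' => hmin ⟨hsN, h'⟩,
        hω s (Finset.mem_range.2 hsN)⟩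
    · right
      exact fun s hs => ⟨hfail s (Nat.lt_succ_iff.1 hs), not_lt.1 fun h' => hex ⟨s, hs, h'⟩,
        hω s (Finset.mem_range.2 hs)⟩
  have h6 : P {ω | ∀ t ≤ N, x t ω ∉ successSet (u i₀) ε} ≤ ENNReal.ofReal
      (2 * (e + √γ) + Real.exp (-(N * (η * Δ / 4 * (1 - X)))) / √(γ * ε / n)) := by
    rw [ENNReal.ofReal_add (by positivity) (by positivity)]
    exact h5.trans ((measure_union_le _ _).trans
      (add_le_add ((measure_biUnion_finset_le _ _).trans h3) h4))
  exact ENNReal.toReal_le_of_le_ofReal (by positivity) h6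

end Failure

/-! ### The initial defect: from the sphere to a Gaussian. -/

lemma defect_smul {V : Type*} [NormedAddCommGroup V] [InnerProductSpace ℝ V] (u : V) (c : ℝ)
    {a : ℝ} (ha : a ≠ 0) (x : V) : defect u c (a • x) = defect u c x := by
  rw [defect, defect, stretch_smul, real_inner_smul_right, norm_smul, mul_pow, mul_pow,
    Real.norm_eq_abs, sq_abs, mul_div_mul_left _ _ (pow_ne_zero 2 ha)]

/-- Integration in polar coordinates of the product of a homogeneous and a radial function. -/
lemma lintegral_homogeneous_mul_radial {E : Type*} [NormedAddCommGroup E] [NormedSpace ℝ E]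
    [MeasurableSpace E] [BorelSpace E] [FiniteDimensional ℝ E] [Nontrivial E] (μ : Measure E)
    [μ.IsAddHaarMeasure] {f : E → ENNReal} (hf : Measurable f)
    (hhom : ∀ a : ℝ, 0 < a → ∀ x, f (a • x) = f x) {W : ℝ → ENNReal} (hW : Measurable W) :
    ∫⁻ x, f x * W ‖x‖ ∂μ = (∫⁻ y, f y ∂μ.toSphere)
      * ∫⁻ a, W a ∂Measure.volumeIoiPow (Module.finrank ℝ E - 1) := by
  have h1 : ∫⁻ x, f x * W ‖x‖ ∂μ
      = ∫⁻ x : ({(0 : E)}ᶜ : Set E), f x * W ‖(x : E)‖ ∂μ.comap (↑) := by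
    rw [lintegral_subtype_comap (measurableSet_singleton _).compl fun x => f x * W ‖x‖,
      restrict_compl_singleton]
  rw [h1, ← lintegral_prod_mul (f := fun y : Metric.sphere (0 : E) 1 => f y)
    (g := fun a : Set.Ioi (0 : ℝ) => W a) (hf.comp measurable_subtype_coe).aemeasurable
    (hW.comp measurable_subtype_coe).aemeasurable,
    ← (μ.measurePreserving_homeomorphUnitSphereProd).lintegral_comp_emb
      (Homeomorph.measurableEmbedding _)]
  refine lintegral_congr fun x => ?_
  have hx : (x : E) ≠ 0 := x.2
  simp only [homeomorphUnitSphereProd_apply_fst_coe,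
    homeomorphUnitSphereProd_apply_snd_coe]
  rw [hhom _ (inv_pos.2 (norm_pos_iff.2 hx))]

/-- The mean of a homogeneous function over a sphere is its mean with respect to any radial
probability density. -/
lemma lintegral_uniformSphere {n : ℕ} (hn : n ≠ 0) {r : ℝ} (hr : 0 < r)
    {f : EuclideanSpace ℝ (Fin n) → ENNReal} (hf : Measurable f)
    (hhom : ∀ a : ℝ, 0 < a → ∀ x, f (a • x) = f x) {W : ℝ → ENNReal} (hW : Measurable W)
    (hW1 : ∫⁻ x : EuclideanSpace ℝ (Fin n), W ‖x‖ = 1) :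
    ∫⁻ x, f x ∂uniformSphere n r = ∫⁻ x, f x * W ‖x‖ := by
  have : Nonempty (Fin n) := ⟨⟨0, Nat.pos_of_ne_zero hn⟩⟩
  have h1 := lintegral_homogeneous_mul_radial volume hf hhom hW
  have h2 := lintegral_homogeneous_mul_radial
    (volume : Measure (EuclideanSpace ℝ (Fin n))) measurable_one (fun _ _ _ => rfl) hW
  simp only [Pi.one_apply, one_mul, lintegral_one] at h2
  rw [hW1] at h2
  have h3 := ENNReal.eq_inv_of_mul_eq_one_left ((mul_comm _ _).trans h2.symm)
  rw [h1, h3, uniformSphere, lintegral_map hf (by fun_prop), lintegral_smul_measure, smul_eq_mul,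
    mul_comm]
  simp_rw [hhom r hr]

/-- Tonelli's theorem for a product of functions of one coordinate each. -/
lemma lintegral_prod_apply {k : ℕ} {f : Fin k → ℝ → ENNReal} (hf : ∀ i, Measurable (f i)) :
    ∫⁻ z : Fin k → ℝ, ∏ i, f i (z i) = ∏ i, ∫⁻ y, f i y := by
  induction k with
  | zero => simp [volume_pi]
  | succ k ih =>
    have h1 := (volume_preserving_piFinSuccAbove (fun _ : Fin (k + 1) => ℝ) 0).lintegral_comp_emb
      (MeasurableEquiv.measurableEmbedding _)
      (fun p : ℝ × (Fin k → ℝ) => f 0 p.1 * ∏ i, f (Fin.succ i) (p.2 i))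
    rw [Fin.prod_univ_succ, ← ih fun i => hf i.succ,
      ← lintegral_prod_mul (hf 0).aemeasurable
      (Finset.measurable_prod _ fun i _ =>
        (hf i.succ).comp (measurable_pi_apply i)).aemeasurable, ← Measure.volume_eq_prod, ← h1]
    refine lintegral_congr fun z => ?_
    rw [Fin.prod_univ_succ]
    rfl

lemma lintegral_sq_gaussianPDF :
    ∫⁻ y, ENNReal.ofReal (y ^ 2) * gaussianPDF 0 1 y = 1 := by
  have h1 : ∫⁻ y, ENNReal.ofReal (y ^ 2) ∂gaussianReal 0 1 = 1 := by
    have h2 := variance_id_gaussianReal (μ := 0) (v := 1)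
    rw [variance_of_integral_eq_zero (by fun_prop) (by simp)] at h2
    rw [← ofReal_integral_eq_lintegral_ofReal]
    · simp only [id] at h2
      rw [h2]; simp
    -- Were y² not integrable, its Bochner integral would be 0 by convention, contradicting the
    -- variance 1.
    · by_contra hcon
      simp only [id] at h2
      rw [integral_undef hcon] at h2
      norm_num at h2
    · exact Filter.Eventually.of_forall fun y => sq_nonneg y
  rw [gaussianReal_of_var_ne_zero _ one_ne_zero,
    lintegral_withDensity_eq_lintegral_mul _ (measurable_gaussianPDF 0 1) (by fun_prop)] at h1
  rw [← h1]
  exact lintegral_congr fun y => mul_comm _ _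

lemma gaussianPDF_zero_one (y : ℝ) :
    gaussianPDF 0 1 y = ENNReal.ofReal ((√(2 * Real.pi))⁻¹ * Real.exp (-(y ^ 2) / 2)) := by
  rw [gaussianPDF, gaussianPDFReal]; simp

/-- A Cauchy density integrated against the Gaussian density. -/
lemma lintegral_cauchy_mul_gaussianPDF_le {b : ℝ} (hb : 0 ≤ b) :
    ∫⁻ y, ENNReal.ofReal (1 - y ^ 2 / (y ^ 2 + b)) * gaussianPDF 0 1 y
      ≤ ENNReal.ofReal (√(Real.pi / 2) * √b) := by
  rcases hb.eq_or_lt with rfl | hb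
  · have h0 : ∀ᵐ y : ℝ, y ≠ 0 := by simp [ae_iff]
    refine (lintegral_congr_ae (g := fun _ => 0) ?_).trans_le (by simp)
    filter_upwards [h0] with y hy
    simp [div_self (pow_ne_zero 2 hy)]
  have hsb := Real.sqrt_pos.2 hb
  have hsb2 := Real.sq_sqrt hb.le
  have h2π : 0 < √(2 * Real.pi) := by positivity
  have h1 : ∀ y, 1 - y ^ 2 / (y ^ 2 + b) = (1 + (y / √b) ^ 2)⁻¹ := by
    intro y
    rw [div_pow, hsb2]; field_simp; ring
  have hint : Integrable fun y : ℝ => (√(2 * Real.pi))⁻¹ * (1 + (y / √b) ^ 2)⁻¹ :=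
    (integrable_inv_one_add_sq.comp_div hsb.ne').const_mul _
  calc _ ≤ ∫⁻ y, ENNReal.ofReal ((√(2 * Real.pi))⁻¹ * (1 + (y / √b) ^ 2)⁻¹) := by
        refine lintegral_mono fun y => ?_
        rw [gaussianPDF_zero_one, h1, ← ENNReal.ofReal_mul (by positivity)]
        refine ENNReal.ofReal_le_ofReal ?_
        have : Real.exp (-(y ^ 2) / 2) ≤ 1 := Real.exp_le_one_iff.2 (by nlinarith [sq_nonneg y])
        have h3 : 0 ≤ (1 + (y / √b) ^ 2)⁻¹ * (√(2 * Real.pi))⁻¹ := by positivity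
        calc _ = (1 + (y / √b) ^ 2)⁻¹ * (√(2 * Real.pi))⁻¹ * Real.exp (-(y ^ 2) / 2) := by ring
          _ ≤ (1 + (y / √b) ^ 2)⁻¹ * (√(2 * Real.pi))⁻¹ := mul_le_of_le_one_right h3 this
          _ = _ := mul_comm _ _
    _ = ENNReal.ofReal (∫ y, (√(2 * Real.pi))⁻¹ * (1 + (y / √b) ^ 2)⁻¹) :=
        (ofReal_integral_eq_lintegral_ofReal hint
          (Filter.Eventually.of_forall fun y => by positivity)).symm
    _ = _ := by
        rw [integral_const_mul, Measure.integral_comp_div (fun y => (1 + y ^ 2)⁻¹),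
          integral_univ_inv_one_add_sq, abs_of_pos hsb, smul_eq_mul]
        congr 1
        have h4 : √(Real.pi / 2) * √(2 * Real.pi) = Real.pi := by
          rw [← Real.sqrt_mul (by positivity), show Real.pi / 2 * (2 * Real.pi) = Real.pi ^ 2 by ring,
            Real.sqrt_sq Real.pi_pos.le]
        field_simp
        linarith

/-- The mean of the defect in Gaussian coordinates. -/
lemma lintegral_gaussian_defect_le {k : ℕ} {γ g : ℝ} (hγ : 0 < γ) (hg : 0 ≤ g)
    (hgk : g * k ≤ γ) :
    ∫⁻ z : Fin k → ℝ, (∫⁻ y, ENNReal.ofReal (1 - y ^ 2 / (y ^ 2 + g * ∑ j, z j ^ 2))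
        * gaussianPDF 0 1 y) * ∏ j, gaussianPDF 0 1 (z j)
      ≤ ENNReal.ofReal √(Real.pi * γ / 2) := by
  have hsγ := Real.sqrt_pos.2 hγ
  have hsγ2 := Real.sq_sqrt hγ.le
  have hw := measurable_gaussianPDF 0 1
  have hone : ∫⁻ z : Fin k → ℝ, ∏ j, gaussianPDF 0 1 (z j) = 1 := by
    rw [lintegral_prod_apply fun _ => hw]
    simp [lintegral_gaussianPDF_eq_one]
  have hsq : ∀ i, ∫⁻ z : Fin k → ℝ, ENNReal.ofReal (z i ^ 2) * ∏ j, gaussianPDF 0 1 (z j) = 1 := by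
    intro i
    have h1 : ∀ z : Fin k → ℝ, ENNReal.ofReal (z i ^ 2) * ∏ j, gaussianPDF 0 1 (z j)
        = ∏ j, (if j = i then fun y => ENNReal.ofReal (y ^ 2) * gaussianPDF 0 1 y
          else gaussianPDF 0 1) (z j) := by
      intro z
      rw [← Finset.mul_prod_erase _ _ (Finset.mem_univ i),
        ← Finset.mul_prod_erase _ _ (Finset.mem_univ i), if_pos rfl, mul_assoc]
      congr 2
      refine Finset.prod_congr rfl fun j hj => ?_
      rw [if_neg (Finset.ne_of_mem_erase hj)]
    simp_rw [h1]
    rw [lintegral_prod_apply]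
    · refine Finset.prod_eq_one fun j _ => ?_
      split_ifs
      · exact lintegral_sq_gaussianPDF
      · exact lintegral_gaussianPDF_eq_one 0 one_ne_zero
    · intro j
      split_ifs
      · exact (by fun_prop : Measurable fun y : ℝ => ENNReal.ofReal (y ^ 2)).mul hw
      · exact hw
  set B := √(Real.pi / 2) * (√γ / 2)
  set B' := √(Real.pi / 2) * (g / (2 * √γ))
  have hB : 0 ≤ B := by positivity
  have hB' : 0 ≤ B' := by positivity
  have hpt : ∀ z : Fin k → ℝ, ∫⁻ y, ENNReal.ofReal (1 - y ^ 2
      / (y ^ 2 + g * ∑ j, z j ^ 2)) * gaussianPDF 0 1 y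
      ≤ ENNReal.ofReal B + ENNReal.ofReal B' * ∑ j, ENNReal.ofReal (z j ^ 2) := by
    intro z
    have hρ : 0 ≤ ∑ j, z j ^ 2 := Finset.sum_nonneg fun _ _ => sq_nonneg _
    refine (lintegral_cauchy_mul_gaussianPDF_le (mul_nonneg hg hρ)).trans ?_
    rw [← ENNReal.ofReal_sum_of_nonneg fun _ _ => sq_nonneg _, ← ENNReal.ofReal_mul hB',
      ← ENNReal.ofReal_add hB (mul_nonneg hB' hρ)]
    refine ENNReal.ofReal_le_ofReal ?_
    have e1 := Real.sq_sqrt (mul_nonneg hg hρ)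
    -- AM-GM balanced at √γ, since g·∑z² has mean at most γ; the right side needs only second
    -- moments.
    have e2 : √(g * ∑ j, z j ^ 2) ≤ √γ / 2 + g / (2 * √γ) * ∑ j, z j ^ 2 := by
      have e3 : √γ / 2 + g / (2 * √γ) * ∑ j, z j ^ 2 - √(g * ∑ j, z j ^ 2)
          = (√γ - √(g * ∑ j, z j ^ 2)) ^ 2 / (2 * √γ) := by
        rw [sub_sq, e1]; field_simp; ring
      have : 0 ≤ (√γ - √(g * ∑ j, z j ^ 2)) ^ 2 / (2 * √γ) := by positivity
      linarith
    calc _ ≤ √(Real.pi / 2) * (√γ / 2 + g / (2 * √γ) * ∑ j, z j ^ 2) :=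
          mul_le_mul_of_nonneg_left e2 (Real.sqrt_nonneg _)
      _ = _ := by ring
  calc _ ≤ ∫⁻ z : Fin k → ℝ, (ENNReal.ofReal B * ∏ j, gaussianPDF 0 1 (z j)
        + ENNReal.ofReal B' * ∑ i, ENNReal.ofReal (z i ^ 2) * ∏ j, gaussianPDF 0 1 (z j)) := by
        refine lintegral_mono fun z => (mul_le_mul_left (hpt z) _).trans (le_of_eq ?_)
        rw [add_mul, mul_assoc, Finset.sum_mul]
    _ = ENNReal.ofReal B + ENNReal.ofReal B' * k := by
        have hm : Measurable fun z : Fin k → ℝ => ∏ j, gaussianPDF 0 1 (z j) :=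
          Finset.measurable_prod _ fun j _ => hw.comp (measurable_pi_apply j)
        have hm2 : ∀ i, Measurable fun z : Fin k → ℝ =>
            ENNReal.ofReal (z i ^ 2) * ∏ j, gaussianPDF 0 1 (z j) :=
          fun i => (by fun_prop : Measurable fun z : Fin k → ℝ => ENNReal.ofReal (z i ^ 2)).mul hm
        rw [lintegral_add_left (hm.const_mul _), lintegral_const_mul _ hm,
          lintegral_const_mul _ (Finset.measurable_sum _ fun i _ => hm2 i),
          lintegral_finsetSum _ fun i _ => hm2 i, hone]
        simp_rw [hsq]
        simp
    _ = ENNReal.ofReal (B + B' * k) := by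
        rw [ENNReal.ofReal_add hB (by positivity), ENNReal.ofReal_mul hB', ENNReal.ofReal_natCast]
    _ ≤ _ := by
        refine ENNReal.ofReal_le_ofReal ?_
        have e4 : g / (2 * √γ) * k ≤ √γ / 2 := by
          rw [div_mul_eq_mul_div, div_le_iff₀ (by positivity)]
          calc g * k ≤ γ := hgk
            _ = √γ / 2 * (2 * √γ) := by rw [show √γ / 2 * (2 * √γ) = √γ ^ 2 by ring, hsγ2]
        calc B + B' * k = √(Real.pi / 2) * (√γ / 2 + g / (2 * √γ) * k) := by ring
          _ ≤ √(Real.pi / 2) * (√γ / 2 + √γ / 2) := by gcongr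
          _ = √(Real.pi * γ / 2) := by
            rw [add_halves, ← Real.sqrt_mul (by positivity)]; ring_nf

/-- The coordinates of a Gaussian vector in an orthonormal basis are independent. -/
lemma lintegral_eq_lintegral_coordinates {n : ℕ}
    (u : OrthonormalBasis (Fin n) ℝ (EuclideanSpace ℝ (Fin n)))
    {F : EuclideanSpace ℝ (Fin n) → ENNReal} (hF : Measurable F) :
    ∫⁻ x, F x = ∫⁻ z : Fin n → ℝ, F (u.repr.symm (WithLp.toLp 2 z)) :=
  ((u.measurePreserving_repr_symm.comp (PiLp.volume_preserving_toLp (Fin n))).lintegral_comp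
    hF).symm

/-- The mean defect of a uniformly random point of a sphere. -/
lemma lintegral_defect_uniformSphere_le {n : ℕ} (hn : n ≠ 0)
    (u : OrthonormalBasis (Fin n) ℝ (EuclideanSpace ℝ (Fin n))) (i₀ : Fin n) {γ r : ℝ}
    (hγ : 0 < γ) (hr : 0 < r) :
    ∫⁻ x, ENNReal.ofReal (defect (u i₀) (√(γ / n)) x) ∂uniformSphere n r
      ≤ ENNReal.ofReal √(Real.pi * γ / 2) := by
  set W : ℝ → ENNReal := fun a =>
    ENNReal.ofReal ((√(2 * Real.pi))⁻¹ ^ n * Real.exp (-(a ^ 2) / 2)) with hWdef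
  have hW : Measurable W := by fun_prop
  have hnorm : ∀ z : Fin n → ℝ, ‖u.repr.symm (WithLp.toLp 2 z)‖ ^ 2 = ∑ i, z i ^ 2 := by
    intro z
    rw [LinearIsometryEquiv.norm_map, EuclideanSpace.real_norm_sq_eq]
  have hWz : ∀ z : Fin n → ℝ, W ‖u.repr.symm (WithLp.toLp 2 z)‖ = ∏ i, gaussianPDF 0 1 (z i) := by
    intro z
    simp_rw [gaussianPDF_zero_one, hWdef]
    rw [← ENNReal.ofReal_prod_of_nonneg fun _ _ => by positivity, hnorm, Finset.prod_mul_distrib,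
      ← Real.exp_sum, Finset.prod_const, Finset.card_univ, Fintype.card_fin, ← Finset.sum_div,
      Finset.sum_neg_distrib]
  have hW1 : ∫⁻ x : EuclideanSpace ℝ (Fin n), W ‖x‖ = 1 := by
    rw [lintegral_eq_lintegral_coordinates u (F := fun x => W ‖x‖) (hW.comp measurable_norm)]
    simp_rw [hWz]
    rw [lintegral_prod_apply fun _ => measurable_gaussianPDF 0 1]
    simp [lintegral_gaussianPDF_eq_one]
  have hf : Measurable fun x => ENNReal.ofReal (defect (u i₀) (√(γ / n)) x) := by fun_prop
  rw [lintegral_uniformSphere hn hr hf (fun a ha x => by rw [defect_smul _ _ ha.ne']) hW hW1,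
    lintegral_eq_lintegral_coordinates u
      (F := fun x => ENNReal.ofReal (defect (u i₀) (√(γ / n)) x) * W ‖x‖)
      (hf.mul (hW.comp measurable_norm))]
  -- The coordinate along `u i₀` is integrated first, with the other k = n - 1 coordinates fixed.
  obtain ⟨k, rfl⟩ := Nat.exists_eq_succ_of_ne_zero hn
  have hn0 : (0 : ℝ) < (k + 1 : ℕ) := by positivity
  have hg : 0 < γ / (k + 1 : ℕ) := by positivity
  set g := γ / (k + 1 : ℕ) with hgdef
  set G : ℝ × (Fin k → ℝ) → ENNReal := fun p => ENNReal.ofReal (1 - p.1 ^ 2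
    / (p.1 ^ 2 + g * ∑ j, p.2 j ^ 2)) * gaussianPDF 0 1 p.1 * ∏ j, gaussianPDF 0 1 (p.2 j) with hG
  have hw := measurable_gaussianPDF 0 1
  have hGm : Measurable G := by
    refine Measurable.mul (Measurable.mul ?_ (hw.comp measurable_fst)) ?_
    · fun_prop
    · exact Finset.measurable_prod _ fun j _ =>
        hw.comp ((measurable_pi_apply j).comp measurable_snd)
  have hpt : ∀ z : Fin (k + 1) → ℝ,
      ENNReal.ofReal (defect (u i₀) √g (u.repr.symm (WithLp.toLp 2 z)))
        * W ‖u.repr.symm (WithLp.toLp 2 z)‖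
      = G (MeasurableEquiv.piFinSuccAbove (fun _ : Fin (k + 1) => ℝ) i₀ z) := by
    intro z
    have hin : inner ℝ (u i₀) (u.repr.symm (WithLp.toLp 2 z)) = z i₀ := by
      rw [← u.repr_apply_apply, LinearIsometryEquiv.apply_symm_apply]
    rw [hWz, Fin.prod_univ_succAbove _ i₀, ← mul_assoc, defect, norm_stretch_sq (u.norm_eq_one i₀),
      hin, hnorm, Fin.sum_univ_succAbove _ i₀, Real.sq_sqrt hg.le, add_sub_cancel_left]
    rfl
  refine (le_of_eq (lintegral_congr hpt)).trans ?_
  rw [(volume_preserving_piFinSuccAbove (fun _ : Fin (k + 1) => ℝ) i₀).lintegral_comp_emb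
      (MeasurableEquiv.measurableEmbedding _) G, Measure.volume_eq_prod,
    lintegral_prod_symm' _ hGm]
  have hgk : g * k ≤ γ := by
    rw [hgdef, div_mul_eq_mul_div, div_le_iff₀ hn0]
    push_cast
    nlinarith
  refine le_trans (le_of_eq (lintegral_congr fun z => ?_))
    (lintegral_gaussian_defect_le hγ hg.le hgk)
  simp only [hG]
  refine lintegral_mul_const (∏ j, gaussianPDF 0 1 (z j)) (f := fun y => ENNReal.ofReal (1 - y ^ 2
    / (y ^ 2 + g * ∑ j, z j ^ 2)) * gaussianPDF 0 1 y) (Measurable.mul ?_ hw)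
  fun_prop

/-! ### Horizon and final constants. -/

/-- The logarithmic horizon is long enough for the exponential term to be small. -/
lemma exp_neg_div_sqrt_le {n γ ε d N : ℝ} (hn : 2 ≤ n) (hγ : 0 < γ) (hε : 0 < ε) (hε1 : ε < 1)
    (hd1 : d ≤ 1 / 2) (hN : Real.log (Real.exp 1 * n / (γ * ε)) - d ≤ N * d) :
    Real.exp (-(N * d)) / √(γ * ε / n) ≤ √γ / 2 := by
  have hγε : 0 < γ * ε / n := by positivity
  have hs := Real.sqrt_pos.2 hγε
  have hs2 := Real.sq_sqrt hγε.le
  have h1 : Real.log (Real.exp 1 * n / (γ * ε)) = 1 - Real.log (γ * ε / n) := by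
    rw [mul_div_assoc, Real.log_mul (Real.exp_pos _).ne' (by positivity), Real.log_exp,
      show n / (γ * ε) = (γ * ε / n)⁻¹ by field_simp, Real.log_inv]
    ring
  -- The factor e inside the logarithm contributes 1 to the exponent, of which at most d ≤ 1/2 is
  -- lost by rounding T down.
  have h2 : Real.exp (-(N * d)) ≤ Real.exp (-(1 / 2)) * (γ * ε / n) := by
    calc _ ≤ Real.exp (-(1 / 2) + Real.log (γ * ε / n)) := Real.exp_le_exp.2 (by linarith)
      _ = _ := by rw [Real.exp_add, Real.exp_log hγε]
  have h3 : Real.exp (-(1 / 2)) ≤ 2 / 3 := by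
    rw [Real.exp_neg, inv_le_comm₀ (Real.exp_pos _) (by norm_num)]
    have := Real.add_one_le_exp (1 / 2 : ℝ)
    linarith
  have h4 : √(γ * ε / n) ≤ 3 / 4 * √γ := by
    rw [Real.sqrt_le_left (by positivity), mul_pow, Real.sq_sqrt hγ.le, div_le_iff₀ (by linarith)]
    nlinarith [mul_pos hγ hε]
  rw [div_le_iff₀ hs]
  calc _ ≤ Real.exp (-(1 / 2)) * (γ * ε / n) := h2
    _ ≤ 2 / 3 * (γ * ε / n) := mul_le_mul_of_nonneg_right h3 hγε.le
    _ = 2 / 3 * √(γ * ε / n) * √(γ * ε / n) := by rw [mul_assoc, ← sq, hs2]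
    _ ≤ 2 / 3 * (3 / 4 * √γ) * √(γ * ε / n) := by gcongr
    _ = _ := by ring

/-- The initial defect, the loss from the stale reads and the survival term together. -/
lemma sum_sqrt_le {γ : ℝ} (hγ : 0 ≤ γ) :
    2 * (√(Real.pi * γ / 2) + √γ) + √γ / 2 ≤ √(8 * Real.pi * γ) := by
  have h1 : √(Real.pi * γ / 2) = √(2 * Real.pi * γ) / 2 := by
    rw [show Real.pi * γ / 2 = 2 * Real.pi * γ / 2 ^ 2 by ring, Real.sqrt_div (by positivity),
      Real.sqrt_sq (by norm_num)]
  have h2 : √(8 * Real.pi * γ) = 2 * √(2 * Real.pi * γ) := by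
    rw [show 8 * Real.pi * γ = 2 ^ 2 * (2 * Real.pi * γ) by ring, Real.sqrt_mul (by norm_num),
      Real.sqrt_sq (by norm_num)]
  -- This is 25/4 ≤ 2π; the extra terms 2√γ + √γ/2 just fit.
  have h3 : 5 / 2 * √γ ≤ √(2 * Real.pi * γ) := by
    refine Real.le_sqrt_of_sq_le ?_
    rw [mul_pow, Real.sq_sqrt hγ]
    nlinarith [Real.pi_gt_d2]
  rw [h1, h2]
  linarith

end Alecton

/-! ### Degenerate cases and verification of the parameter range. -/

theorem corollary3 {n : ℕ} (hn : 2 ≤ n)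
    {Ω Ω' : Type*} {mΩ : MeasurableSpace Ω} {mΩ' : MeasurableSpace Ω'}
    (P : Measure Ω) [IsProbabilityMeasure P] (P' : Measure Ω') [IsProbabilityMeasure P']
    (ℱ : Filtration ℕ mΩ)
    (A : Matrix (Fin n) (Fin n) ℝ) (hA : A.IsSymm)
    (u : OrthonormalBasis (Fin n) ℝ (EuclideanSpace ℝ (Fin n))) (lam : Fin n → ℝ)
    (hu : Alecton.IsOrderedEigenbasis A u lam)
    (Δ : ℝ) (hΔ : Δ = lam ⟨0, by omega⟩ - lam ⟨1, by omega⟩) (hΔ_pos : 0 < Δ)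
    (μ : ℝ) (hμ : Alecton.Incoherent u μ)
    (ε γ ϑ : ℝ) (hε : 0 < ε) (hγ : 0 < γ) (hγ_le : γ ≤ 1)
    (hϑ : 0 < ϑ) (hϑ_lt : ϑ < (1 + ε)⁻¹)
    (η : ℝ) (hη : η = Δ * ε * γ * ϑ / (2 * n * μ ^ 4 * Alecton.frobeniusNorm A ^ 2))
    (T : ℝ) (hT : T = 4 * n * μ ^ 4 * Alecton.frobeniusNorm A ^ 2 /
        (Δ ^ 2 * ε * γ * ϑ * Real.sqrt (2 * Real.pi * γ)) *
      Real.log (Real.exp 1 * n / (γ * ε)))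
    (r : ℝ) (hr : 0 < r)
    (x : ℕ → Ω → EuclideanSpace ℝ (Fin n)) (row col : ℕ → Ω → Fin n)
    (delay : ℕ → Fin n → Ω → ℕ)
    (tauMax : Ω' → ℕ) (htau_meas : Measurable tauMax)
    (htau_int : Integrable (fun ω' => (tauMax ω' : ℝ)) P')
    (hrun : Alecton.IsHogwildRun P P' ℱ A η r x row col delay tauMax)
    (C : ℝ)
    (hbdd : ∀ t : ℕ, t ≤ ⌊T⌋₊ → ∀ᵐ ω ∂P, 1 ≤ ‖x t ω‖ ∧ Alecton.l1Norm (x t ω) ≤ C)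
    (τ : ℝ) (hτ : τ = ∫ ω', (tauMax ω' : ℝ) ∂P')
    (hdelay : 4 * C * ϑ * τ * Real.sqrt ε < μ ^ 2) :
    P.real (Alecton.failureEvent x (Alecton.successSet (u ⟨0, by omega⟩) ε) T) ≤
      Real.sqrt (8 * Real.pi * γ) * μ ^ 2 / (μ ^ 2 - 4 * C * ϑ * τ * Real.sqrt ε) := by
  have hn' : (2 : ℝ) ≤ n := by exact_mod_cast hn
  have hn0 : (0 : ℝ) < n := by linarith
  set i₀ : Fin n := ⟨0, by omega⟩
  set F := Alecton.frobeniusNorm A with hF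
  set X := 4 * C * ϑ * τ * √ε / μ ^ 2 with hX
  have hϑ1 : ϑ < 1 := hϑ_lt.trans (inv_lt_one_of_one_lt₀ (by linarith))
  -- The squared coordinates of a unit vector sum to 1, and each is at most μ²/n.
  have hμ1 : 1 ≤ μ ^ 2 := by
    have h := Finset.sum_le_sum fun j (_ : j ∈ Finset.univ) => hμ j i₀
    rw [Alecton.sum_coord_sq, Finset.sum_const, Finset.card_univ, Fintype.card_fin, nsmul_eq_mul,
      mul_div_cancel₀ _ hn0.ne'] at h
    exact h
  have hμ0 : μ ≠ 0 := by rintro rfl; norm_num at hμ1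
  have hC : 1 ≤ C := by
    obtain ⟨ω, h1, h2⟩ := (hbdd 0 (Nat.zero_le _)).exists
    exact h1.trans ((Alecton.norm_le_l1Norm _).trans h2)
  have hτ0 : 0 ≤ τ := hτ ▸ integral_nonneg fun _ => Nat.cast_nonneg _
  have hX0 : 0 ≤ X := by positivity
  have hX1 : X < 1 := (div_lt_one (by linarith)).2 hdelay
  have hrhs : √(8 * Real.pi * γ) * μ ^ 2 / (μ ^ 2 - 4 * C * ϑ * τ * √ε)
      = √(8 * Real.pi * γ) / (1 - X) := by
    have h1 : μ ^ 2 - 4 * C * ϑ * τ * √ε = (1 - X) * μ ^ 2 := by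
      rw [hX]; field_simp
    rw [h1, mul_div_mul_right _ _ (by linarith)]
  rw [hrhs]
  rcases le_or_gt 1 ε with hε1 | hε1
  · have h0 : Alecton.failureEvent x (Alecton.successSet (u i₀) ε) T = ∅ := by
      refine Set.eq_empty_of_forall_notMem fun ω h => h 0 (Nat.zero_le _) ?_
      have h1 : (1 - ε) * ‖x 0 ω‖ ^ 2 ≤ 0 :=
        mul_nonpos_of_nonpos_of_nonneg (sub_nonpos.2 hε1) (sq_nonneg _)
      exact h1.trans (sq_nonneg _)
    rw [h0, measureReal_empty]
    exact div_nonneg (Real.sqrt_nonneg _) (by linarith)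
  -- In the first case the claimed bound is at least 1; the second forces 8πγ < 1 and makes the
  -- horizon long enough.
  rcases le_or_gt (1 - X) √(8 * Real.pi * γ) with hbig | hsmall
  · exact measureReal_le_one.trans ((one_le_div (by linarith)).2 hbig)
  have hγ25 : γ ≤ 1 / 25 := by
    have h1 : 8 * Real.pi * γ < 1 := by
      have := (Real.sqrt_lt' one_pos).1 (hsmall.trans_le (by linarith))
      linarith
    nlinarith [Real.pi_gt_d2]
  have hgap : ∀ k, k ≠ i₀ → lam k ≤ lam i₀ - Δ := by
    intro k hk
    have h1 : lam k ≤ lam ⟨1, by omega⟩ := by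
      refine hu.antitone (Fin.mk_le_of_le_val ?_)
      exact Nat.one_le_iff_ne_zero.2 fun h => hk (Fin.ext h)
    linarith
  -- (λ₁ - λ₂)² ≤ 2(λ₁² + λ₂²), and F² is the sum of all squared eigenvalues.
  have hgap_sq : Δ ^ 2 ≤ 2 * F ^ 2 := by
    have h1 : lam i₀ ^ 2 + lam ⟨1, by omega⟩ ^ 2 ≤ F ^ 2 := by
      rw [hF, Alecton.frobeniusNorm_sq_eq_sum_eigen hA hu]
      refine Finset.add_le_sum (fun k _ => sq_nonneg (lam k)) (Finset.mem_univ _)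
        (Finset.mem_univ _) ?_
      simp [i₀]
    nlinarith [sq_nonneg (lam i₀ + lam ⟨1, by omega⟩)]
  have hF2 : 0 < F ^ 2 := by nlinarith
  have hF0 : F ≠ 0 := by rintro h; simp [h] at hF2
  have hη0 : 0 < η := by rw [hη]; positivity
  have hstep : 2 * η * n * μ ^ 4 * F ^ 2 = Δ * ε * γ * ϑ := by
    rw [hη]; field_simp
  -- Incoherence always holds with parameter √n, so μ may be capped there; the estimates use m² ≤ n.
  set m := min |μ| √n with hm
  have hm1 : 1 ≤ m := by
    refine le_min ?_ (Real.one_le_sqrt.2 (by linarith))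
    rwa [← one_le_sq_iff_one_le_abs]
  have hm_sq_le : m ^ 2 ≤ μ ^ 2 := by
    rw [← sq_abs μ]
    exact pow_le_pow_left₀ (by linarith) (min_le_left _ _) 2
  have hm_n : m ^ 2 ≤ n := by
    rw [← Real.sq_sqrt hn0.le]
    exact pow_le_pow_left₀ (by linarith) (min_le_right _ _) 2
  have hreg : Alecton.Regime A u lam i₀ Δ m ε γ η C τ X := by
    refine ⟨hn, hA, hu, hgap, hΔ_pos, hgap_sq, fun b k => ?_, hm1, hm_n, hε, hε1, hγ, hγ25, hη0,
      ?_, ?_, hC, hτ0, hX0, hX1.le⟩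
    · rcases min_choice |μ| √n with h | h
      · rw [hm, h, sq_abs]
        exact hμ b k
      · rw [hm, h, Real.sq_sqrt hn0.le, div_self hn0.ne', ← Alecton.sum_coord_sq (u := u) k]
        exact Finset.single_le_sum (f := fun j => u k j ^ 2) (fun _ _ => sq_nonneg _)
          (Finset.mem_univ b)
    · calc 2 * η * n * m ^ 4 * F ^ 2 = 2 * η * n * (m ^ 2) ^ 2 * F ^ 2 := by ring
        _ ≤ 2 * η * n * (μ ^ 2) ^ 2 * F ^ 2 := by gcongr
        _ = Δ * ε * γ * ϑ := by rw [← hstep]; ring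
        _ ≤ Δ * ε * γ := mul_le_of_le_one_right (by positivity) hϑ1.le
    · have h1 : Δ * √ε * γ * X = 8 * η * n * μ ^ 2 * F ^ 2 * C * τ := by
        have hs := Real.sq_sqrt hε.le
        have h2 : Δ * √ε * γ * X * μ ^ 2 = (8 * η * n * μ ^ 2 * F ^ 2 * C * τ) * μ ^ 2 := by
          calc _ = Δ * √ε * γ * (X * μ ^ 2) := by ring
            _ = Δ * √ε * γ * (4 * C * ϑ * τ * √ε) := by
              rw [hX, div_mul_cancel₀ _ (by positivity)]
            _ = 4 * C * τ * (Δ * √ε ^ 2 * γ * ϑ) := by ring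
            _ = 4 * C * τ * (2 * η * n * μ ^ 4 * F ^ 2) := by rw [hs, hstep]
            _ = _ := by ring
        exact mul_right_cancel₀ (by positivity) h2
      rw [h1]
      gcongr
  set d := η * Δ / 4 * (1 - X) with hd
  have hd0 : 0 ≤ d := mul_nonneg (by positivity) (by linarith)
  have hd1 : d ≤ 1 / 2 := by
    have h1 := hreg.progress_le
    have h2 : η * Δ ≤ η * Δ * n * m ^ 4 := by
      rw [mul_assoc (η * Δ)]
      exact le_mul_of_one_le_right (by positivity)
        (one_le_mul_of_one_le_of_one_le (by linarith) (one_le_pow₀ hm1))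
    have h3 : ε * γ ≤ 1 := mul_le_one₀ hε1.le hγ.le hγ_le
    have h4 : d ≤ η * Δ / 4 := mul_le_of_le_one_right (by positivity) (by linarith)
    linarith
  set ℓ := Real.log (Real.exp 1 * n / (γ * ε)) with hℓ
  have hℓ0 : 0 ≤ ℓ := by
    refine Real.log_nonneg ((one_le_div (by positivity)).2 ?_)
    have h1 : γ * ε ≤ 1 := mul_le_one₀ hγ_le hε.le hε1.le
    nlinarith [Real.add_one_le_exp (1 : ℝ)]
  have hTd : ℓ ≤ T * d := by
    have hs : 0 < √(2 * Real.pi * γ) := by positivity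
    have h2 : √(8 * Real.pi * γ) = 2 * √(2 * Real.pi * γ) := by
      rw [show 8 * Real.pi * γ = 2 ^ 2 * (2 * Real.pi * γ) by ring, Real.sqrt_mul (by norm_num),
        Real.sqrt_sq (by norm_num)]
    -- The denominator is √(8πγ), so the quotient is at least 1 in the present case.
    have h3 : T * d = ℓ * ((1 - X) / (2 * √(2 * Real.pi * γ))) := by
      rw [hT, hd, hη]
      field_simp
    rw [h3]
    refine le_mul_of_one_le_right hℓ0 ((one_le_div (by positivity)).2 ?_)
    linarith
  have hNd : ℓ - d ≤ ⌊T⌋₊ * d := by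
    have := mul_le_mul_of_nonneg_right (Nat.sub_one_lt_floor T).le hd0
    linarith
  have he : ∫⁻ ω, ENNReal.ofReal (Alecton.defect (u i₀) (√(γ / n)) (x 0 ω)) ∂P
      ≤ ENNReal.ofReal √(Real.pi * γ / 2) := by
    have h1 := Alecton.lintegral_defect_uniformSphere_le (by omega : n ≠ 0) u i₀ hγ hr
    rwa [← hrun.init_law, lintegral_map (by fun_prop) (hrun.measurable_apply 0)] at h1
  have hmain := hreg.measure_failure_le hrun
    (fun k => (Alecton.sum_tail_le_integral htau_meas htau_int k).trans_eq hτ.symm) ⌊T⌋₊ hbdd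
    (Real.sqrt_nonneg _) he
  calc _ ≤ 2 * (√(Real.pi * γ / 2) + √γ) + Real.exp (-(⌊T⌋₊ * d)) / √(γ * ε / n) := hmain
    _ ≤ 2 * (√(Real.pi * γ / 2) + √γ) + √γ / 2 :=
      add_le_add_right (Alecton.exp_neg_div_sqrt_le hn' hγ hε hε1 hd1 hNd) _
    _ ≤ √(8 * Real.pi * γ) := Alecton.sum_sqrt_le hγ.le
    _ ≤ _ := le_div_self (Real.sqrt_nonneg _) (by linarith) (by linarith)
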